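/- **Model.** A server holds two files $W_1,W_2$, independent and uniform on $\mathbb F_q^F$, and serves $K\ge 1$ users over a shared link. In an *uncoded placement*, user $k$ stores $Z_k=(W_1|_{A_{k,1}},W_2|_{A_{k,2}})$ with $A_{k,i}\subseteq\{1,\dots,F\}$, subject to $H_q(Z_k)\le MF$, where $H_q$ is entropy to base $q$. Users then request files $d_1,\dots,d_K\in\{1,2\}$, i.i.d. with distribution $(p_1,p_2)$, where $p_1+p_2=1$ and $p_1\ge p_2\ge 0$. Given $\mathbf d$, a message $X_{\mathbf d,F}$, a function of $(W_1,W_2)$, is broadcast. The rate $R_{\mathbf d,F}$ is achieved by $X_{\mathbf d,F}$ if every user $k$ recovers $W_{d_k}$ from $(X_{\mathbf d,F},Z_k,\mathbf d)$ with error probability zero and $H_q(X_{\mathbf d,F})\le R_{\mathbf d,F}F$. An expected rate $\bar R$ is achieved by a family of placements and messages (one for each $F$ and $\mathbf d$) if the memory constraint holds and the messages achieve rates $R_{\mathbf d,F}$ with $\limsup_{F\to\infty}\mathbb E_{\mathbf d}R_{\mathbf d,F}\le\bar R$. It is achievable under uncoded placement if some such family achieves it. **Rate expression.** Let $\binom ab=0$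 if $b<0$ or $b>a$, let $c_{i}(n)=\binom{K-i}{n}/\binom Kn$ (terms with coefficient $0$ are read as $0$), and let $g_i(t)=(1+\lfloor t\rfloor-t)\,c_i(\lfloor t\rfloor)+(t-\lfloor t\rfloor)\,c_i(\lfloor t\rfloor+1)$. Put $$\bar R_{t_1,t_2}=p_1^K\tfrac{K-t_1}{K}+p_2^K\tfrac{K-t_2}{K}+(1-p_1^K-p_2^K)\max\{g_1(t_1)+g_2(t_2),\;g_2(t_1)+g_1(t_2)\}.$$ **Scheme at an integer point** $(r_1,r_2)$, $0\le r_2\le r_1\le K$. Break each file into $S=\binom K{r_1}\binom{r_1}{r_2}$ equal subfiles $W_{i,\tau_1,\tau_2}$, with $\tau_2\subseteq\tau_1\subseteq[K]$ and $|\tau_j|=r_j$. User $k$ stores $W_{i,\tau_1,\tau_2}$ iff $k\in\tau_i$. Call a matrix MDS if it has at most as many rows as columns and all its maximal square submatrices are invertible. If only file $i$ is requested, send $\mathcal C W_i$ with $\mathcal C$ an $S\frac{K-r_i}{K}\times S$ MDS matrix. If both are requested, let $\Omega_i$ be the set of users requesting file $i$. For each $i$ and all $\rho_2\subseteq\rho_1\subseteq[K]\setminus\Omega_i$,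 let $\kappa$ be the number of subfiles $W_{i,\rho_1\cup x_1,\rho_2\cup x_2}$ with $x_2\subseteq x_1\subseteq\Omega_i$. Multiply the vector of these subfiles by an MDS matrix with $\kappa$ columns and $\frac{|\Omega_i|-(r_i-|\rho_i|)}{|\Omega_i|}\kappa$ rows. Let $W_i^*$ be the concatenation of the results, and send $\mathcal C[W_1^*;W_2^*]$ with $\mathcal C$ an MDS matrix with $S\max\{c_1(r_1)+c_2(r_2),\,c_2(r_1)+c_1(r_2)\}$ rows. **Joint scheme at** $(t_1,t_2)$. Let $r_i=\lfloor t_i\rfloor$, $f_i=t_i-r_i$. Use three integer points with weights: * if $r_1=r_2=r$: $(r+1,r)$, $(r+1,r+1)$, $(r,r)$ with weights $f_1-f_2,\ f_2,\ 1-f_1$; * if $r_1>r_2$ and $f_1+f_2\ge1$: $(r_1,r_2+1)$, $(r_1+1,r_2)$, $(r_1+1,r_2+1)$ with weights $1-f_1,\ 1-f_2,\ f_1+f_2-1$; * if $r_1>r_2$ and $f_1+f_2<1$: $(r_1+1,r_2)$, $(r_1,r_2+1)$, $(r_1,r_2)$ with weights $f_1,\ f_2,\ 1-f_1-f_2$.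 With $\theta_j$ the weights and $P_j=\theta_1+\dots+\theta_j$, part $j$ of a file consists of the positions $n$ with $P_{j-1}F<n\le P_jF$. The scheme at the $j$-th integer point, with $S_j$ subfiles, is applied to part $j$, with subfiles of $\lfloor\theta_jF/S_j\rfloor$ symbols (parts of weight $0$ are empty). The boundedly many symbols left over by rounding are not cached and, for the requested files, are sent uncoded. **Theorem.** For every $K\ge1$ there is $q_0$ such that, for every finite field $\mathbb F_q$ with $q\ge q_0$, all $p_1\ge p_2\ge0$ with $p_1+p_2=1$, and all $0\le M\le 2$, the smallest expected delivery rate achievable under uncoded placement exists and equals $$\bar R^*=\min_{\substack{0\le t_2\le t_1\le K\\ t_1+t_2=KM}}\bar R_{t_1,t_2},$$ where the minimum is attained. Furthermore, for every minimizer $(t_1,t_2)$ the joint scheme at $(t_1,t_2)$ achieves the expected rate $\bar R^*$: for every $F$ the subfiles and MDS matrices it needs exist over $\mathbb F_q$, and every choice of them for all $F$ gives a family of placements and messages that achieves $\bar R^*$. -/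

import Mathlib

universe u v w

namespace CodedCaching

/-! ### Finite uniform probability spaces and Shannon entropy -/

/-- Probability of the event `E` under the uniform distribution on the finite type `Ω`. -/
noncomputable def uprob {Ω : Type v} [Fintype Ω] (E : Set Ω) : ℝ :=
  (E.ncard : ℝ) / (Fintype.card Ω : ℝ)

open Classical in
/-- Base-`q` Shannon entropy `H_q(X)` of the random variable `X` on the uniform space `Ω`;
the sum is over the values that `X` takes. -/
noncomputable def entropy {Ω : Type v} {A : Type w} [Fintype Ω] (q : ℕ) (X : Ω → A) : ℝ :=
  -∑ x ∈ Finset.univ.image X, uprob (X ⁻¹' {x}) * Real.logb q (uprob (X ⁻¹' {x}))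

/-! ### The caching model -/

/-- `N` files, each consisting of `F` symbols of `𝔽`. The random files are uniform on this type,
that is, all symbols are independent and uniform. -/
abbrev Files (𝔽 : Type u) (N F : ℕ) : Type u := Fin N → Fin F → 𝔽

/-- An uncoded placement for files of `F` symbols: user `k` stores the symbols of file `i` whose
positions lie in `A k i`. -/
abbrev UncodedPlacement (K N F : ℕ) : Type := Fin K → Fin N → Finset (Fin F)

/-- The cache content `Z_k` of user `k`, as a function of the files. -/
def cache {𝔽 : Type u} {K N F : ℕ} (A : UncodedPlacement K N F) (k : Fin K)
    (W : Files 𝔽 N F) : (i : Fin N) → {x : Fin F // x ∈ A k i} → 𝔽 :=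
  fun i x => W i x

/-- From the delivery message `X`, the own cache and the (fixed) request vector `d`, every user
recovers the requested file with error probability zero. -/
def Decodable {𝔽 : Type u} [Fintype 𝔽] {K N F : ℕ} (A : UncodedPlacement K N F)
    (d : Fin K → Fin N) {B : Type u} (X : Files 𝔽 N F → B) : Prop :=
  ∃ g : (k : Fin K) → B → ((i : Fin N) → {x : Fin F // x ∈ A k i} → 𝔽) → (Fin F → 𝔽),
    ∀ k, uprob {W : Files 𝔽 N F | g k (X W) (cache A k W) ≠ W (d k)} = 0

/-- The placements `A F` and delivery messages `X F d` (one for every file size `F` and request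
vector `d`) respect the cache size `M` and achieve the expected delivery rate `Rbar` when the
requests are i.i.d. with distribution `p`. The upper limit is taken in the extended reals. -/
def AchievesExpectedRate {𝔽 : Type u} [Fintype 𝔽] {K N : ℕ} (M : ℝ) (p : Fin N → ℝ)
    (A : (F : ℕ) → UncodedPlacement K N F)
    {B : (F : ℕ) → (Fin K → Fin N) → Type u}
    (X : (F : ℕ) → (d : Fin K → Fin N) → Files 𝔽 N F → B F d) (Rbar : ℝ) : Prop :=
  (∀ (F : ℕ) (k : Fin K),
      entropy (Fintype.card 𝔽) (cache (𝔽 := 𝔽) (A F) k) ≤ M * F) ∧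
  ∃ R : (Fin K → Fin N) → ℕ → ℝ,
    (∀ d F, Decodable (A F) d (X F d) ∧ entropy (Fintype.card 𝔽) (X F d) ≤ R d F * F) ∧
    Filter.limsup
      (fun F : ℕ => ((∑ d : Fin K → Fin N, (∏ k, p (d k)) * R d F : ℝ) : EReal))
      Filter.atTop ≤ (Rbar : EReal)

/-- The expected delivery rate `Rbar` is achievable under uncoded placement with cache size `M`. -/
def ExpectedRateAchievable (𝔽 : Type u) [Fintype 𝔽] (K N : ℕ) (M : ℝ) (p : Fin N → ℝ)
    (Rbar : ℝ) : Prop :=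
  ∃ (A : (F : ℕ) → UncodedPlacement K N F)
    (B : (F : ℕ) → (Fin K → Fin N) → Type u)
    (X : (F : ℕ) → (d : Fin K → Fin N) → Files 𝔽 N F → B F d),
    AchievesExpectedRate M p A X Rbar

/-! ### The explicit rate for two files -/

/-- The binomial coefficient of two integers, zero if `b < 0` or `b > a`. -/
def binom (a b : ℤ) : ℕ := if 0 ≤ b ∧ b ≤ a then a.toNat.choose b.toNat else 0

/-- `C(K - i, n) / C(K, n)`. -/
noncomputable def ratio (K : ℕ) (i n : ℤ) : ℝ :=
  (binom ((K : ℤ) - i) n : ℝ) / (binom (K : ℤ) n : ℝ)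

/-- Linear interpolation of `n ↦ C(K - i, n) / C(K, n)` between consecutive integers. -/
noncomputable def interp (K : ℕ) (i : ℤ) (t : ℝ) : ℝ :=
  (1 + (⌊t⌋ : ℝ) - t) * ratio K i ⌊t⌋ + (t - (⌊t⌋ : ℝ)) * ratio K i (⌊t⌋ + 1)

/-- The rate expression `R̄_{t₁,t₂}`, with `t = (t₁, t₂)` and popularities `p 0`, `p 1` of the first
and the second file. -/
noncomputable def rateBar (K : ℕ) (p : Fin 2 → ℝ) (t : ℝ × ℝ) : ℝ :=
  p 0 ^ K * ((K - t.1) / K) + p 1 ^ K * ((K - t.2) / K) +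
    (1 - p 0 ^ K - p 1 ^ K) *
      max (interp K 1 t.1 + interp K 2 t.2) (interp K 2 t.1 + interp K 1 t.2)

/-- The cache allocations `0 ≤ t₂ ≤ t₁ ≤ K` with `t₁ + t₂ = K M`. -/
def allocations (K : ℕ) (M : ℝ) : Set (ℝ × ℝ) :=
  {t | 0 ≤ t.2 ∧ t.2 ≤ t.1 ∧ t.1 ≤ K ∧ t.1 + t.2 = K * M}

/-! ### Placement and delivery at an integer point `(r 0, r 1)` -/

/-- Labels of the subfiles: pairs of sets of users `τ 1 ⊆ τ 0` with `|τ i| = r i`. User `k` stores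
the subfile of file `i` with label `τ` if and only if `k ∈ τ i`. -/
abbrev Label (K : ℕ) (r : Fin 2 → ℕ) : Type :=
  {τ : Fin 2 → Finset (Fin K) // τ 1 ⊆ τ 0 ∧ ∀ i, (τ i).card = r i}

/-- The number `S` of subfiles of each file. -/
def numSub (K : ℕ) (r : Fin 2 → ℕ) : ℕ := Fintype.card (Label K r)

/-- A matrix is MDS if it has at most as many rows as columns and every maximal square submatrix
(all rows, arbitrary distinct columns) is invertible. -/
def IsMDS {𝔽 : Type u} [Field 𝔽] {m : Type v} {n : Type w} [Fintype m] [DecidableEq m] [Fintype n]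
    (C : Matrix m n 𝔽) : Prop :=
  Fintype.card m ≤ Fintype.card n ∧ ∀ e : m ↪ n, IsUnit (C.submatrix id e)

/-- The set `Ω_i` of the users that request file `i`. -/
def requesters {K : ℕ} (d : Fin K → Fin 2) (i : Fin 2) : Finset (Fin K) :=
  Finset.univ.filter fun k => d k = i

/-- Both files are requested. -/
def Mixed {K : ℕ} (d : Fin K → Fin 2) : Prop := ∀ i, ∃ k, d k = i

/-- For a pair `ρ` of sets of users that do not request file `i`: the labels
`(ρ 0 ∪ x 0, ρ 1 ∪ x 1)` with `x 0`, `x 1` sets of users that request file `i`. -/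
abbrev Group (K : ℕ) (r : Fin 2 → ℕ) (d : Fin K → Fin 2) (i : Fin 2)
    (ρ : Fin 2 → Finset (Fin K)) : Type :=
  {τ : Label K r // ∀ l, τ.1 l ∩ (requesters d i)ᶜ = ρ l}

/-- The number `θ_i = (K_i - (r_i - s_i)) κ_i / K_i` of coded packets formed from a group, where
`κ_i` is the size of the group, `s_i = |ρ_i|` and `K_i = |Ω_i|`. The division is exact. -/
def encRows (K : ℕ) (r : Fin 2 → ℕ) (d : Fin K → Fin 2) (i : Fin 2)
    (ρ : Fin 2 → Finset (Fin K)) : ℕ :=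
  ((requesters d i).card - (r i - (ρ i).card)) * Fintype.card (Group K r d i ρ) /
    (requesters d i).card

/-- Indices of the packets of the concatenation `[W₁*; W₂*]`. -/
abbrev EncIdx (K : ℕ) (r : Fin 2 → ℕ) (d : Fin K → Fin 2) : Type :=
  Σ i : Fin 2, Σ ρ : Fin 2 → Finset (Fin K), Fin (encRows K r d i ρ)

/-- `S (K - r_i) / K`; the division is exact. -/
def singleRows (K : ℕ) (r : Fin 2 → ℕ) (i : Fin 2) : ℕ := numSub K r * (K - r i) / K

/-- `S C(K - c, r_i) / C(K, r_i)`; the division is exact. -/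
def share (K : ℕ) (r : Fin 2 → ℕ) (c : ℕ) (i : Fin 2) : ℕ :=
  numSub K r * (K - c).choose (r i) / K.choose (r i)

/-- `S R` for the rate `R` used when both files are requested. -/
def jointRows (K : ℕ) (r : Fin 2 → ℕ) : ℕ :=
  max (share K r 1 1 + share K r 2 0) (share K r 1 0 + share K r 2 1)

/-- The MDS matrices used by the delivery for the request vector `d`. -/
structure DeliveryCodes (𝔽 : Type u) [Field 𝔽] (K : ℕ) (r : Fin 2 → ℕ) (d : Fin K → Fin 2) where
  /-- used if only file `i` is requested -/
  single : (i : Fin 2) → Matrix (Fin (singleRows K r i)) (Label K r) 𝔽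
  single_mds : ∀ i, IsMDS (single i)
  /-- compresses each group of subfiles of file `i` -/
  enc : (i : Fin 2) → (ρ : Fin 2 → Finset (Fin K)) →
    Matrix (Fin (encRows K r d i ρ)) (Group K r d i ρ) 𝔽
  enc_mds : Mixed d → ∀ i ρ, IsMDS (enc i ρ)
  /-- encodes the concatenation of the two compressed files -/
  joint : Matrix (Fin (jointRows K r)) (EncIdx K r d) 𝔽
  joint_mds : Mixed d → IsMDS joint

/-- A finite list of packets of `b` symbols. -/
abbrev Packets (𝔽 : Type u) (b : ℕ) : Type u := Σ n : ℕ, Fin n → Fin b → 𝔽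

/-- The packets of `[W₁*; W₂*]`, where `w i τ` is the subfile of file `i` with label `τ`. -/
def compressed {𝔽 : Type u} [Field 𝔽] {K : ℕ} {r : Fin 2 → ℕ} {d : Fin K → Fin 2}
    (c : DeliveryCodes 𝔽 K r d) {b : ℕ} (w : Fin 2 → Label K r → Fin b → 𝔽) :
    EncIdx K r d → Fin b → 𝔽 :=
  fun e s => ∑ τ : Group K r d e.1 e.2.1, c.enc e.1 e.2.1 e.2.2 τ * w e.1 τ.1 s

open Classical in
/-- The delivery message for the request vector `d`. If only file `i` is requested, it is an
MDS-coded version of the subfiles of file `i`; otherwise, an MDS-coded version of `[W₁*; W₂*]`. -/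
noncomputable def deliver {𝔽 : Type u} [Field 𝔽] {K : ℕ} {r : Fin 2 → ℕ} {d : Fin K → Fin 2}
    (c : DeliveryCodes 𝔽 K r d) {b : ℕ} (w : Fin 2 → Label K r → Fin b → 𝔽) : Packets 𝔽 b :=
  if ∀ k, d k = 0 then ⟨singleRows K r 0, fun a s => ∑ τ, c.single 0 a τ * w 0 τ s⟩
  else if ∀ k, d k = 1 then ⟨singleRows K r 1, fun a s => ∑ τ, c.single 1 a τ * w 1 τ s⟩
  else ⟨jointRows K r, fun a s => ∑ e, c.joint a e * compressed c w e s⟩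

/-! ### The joint scheme: memory sharing between three integer points -/

open Classical in
/-- The three pairs (weight `θ_j`, integer point `Q_j`) used for memory sharing at `t`. If the two
integer parts agree, the three corners `(r, r)`, `(r + 1, r)`, `(r + 1, r + 1)` of the unit square
around `t` are used. -/
noncomputable def sharing (t : ℝ × ℝ) : Fin 3 → ℝ × (Fin 2 → ℕ) :=
  let r₁ : ℕ := ⌊t.1⌋₊
  let r₂ : ℕ := ⌊t.2⌋₊
  let f₁ : ℝ := t.1 - r₁
  let f₂ : ℝ := t.2 - r₂
  if r₁ = r₂ then
    ![(f₁ - f₂, ![r₁ + 1, r₁]), (f₂, ![r₁ + 1, r₁ + 1]), (1 - f₁, ![r₁, r₁])]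
  else if 1 ≤ f₁ + f₂ then
    ![(1 - f₁, ![r₁, r₂ + 1]), (1 - f₂, ![r₁ + 1, r₂]), (f₁ + f₂ - 1, ![r₁ + 1, r₂ + 1])]
  else
    ![(f₁, ![r₁ + 1, r₂]), (f₂, ![r₁, r₂ + 1]), (1 - f₁ - f₂, ![r₁, r₂])]

/-- The weight `θ_j`. -/
noncomputable def weight (t : ℝ × ℝ) (j : Fin 3) : ℝ := (sharing t j).1

/-- The integer point `Q_j`. -/
noncomputable def point (t : ℝ × ℝ) (j : Fin 3) : Fin 2 → ℕ := (sharing t j).2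

/-- The number of symbols of one subfile in part `j`, the integer part of `θ_j F / S_j`. -/
noncomputable def subSize (K : ℕ) (t : ℝ × ℝ) (F : ℕ) (j : Fin 3) : ℕ :=
  ⌊weight t j * F / numSub K (point t j)⌋₊

/-- The free choices of the joint scheme at the allocation `t` for files of `F` symbols.
Part `j` of each file consists of the positions `n` (counted from one) with
`P_{j-1} F < n ≤ P_j F`, where `P_j` is the sum of the first `j` weights. Each part is broken into
disjoint subfiles of `subSize` symbols; fewer than `S_j + 1` positions of part `j` are left over by
rounding. -/
structure JointChoices (𝔽 : Type u) [Field 𝔽] (K : ℕ) (t : ℝ × ℝ) (F : ℕ) where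
  /-- the position of symbol `s` of the subfile with label `τ` in part `j` of file `i` -/
  pos : (i : Fin 2) → (j : Fin 3) → Label K (point t j) → Fin (subSize K t F j) → Fin F
  pos_inj : ∀ i j τ s τ' s', pos i j τ s = pos i j τ' s' → τ = τ' ∧ s = s'
  lt_pos : ∀ i j τ s, (∑ l ∈ Finset.Iio j, weight t l) * F < (pos i j τ s : ℝ) + 1
  pos_le : ∀ i j τ s, (pos i j τ s : ℝ) + 1 ≤ (∑ l ∈ Finset.Iic j, weight t l) * F
  codes : (j : Fin 3) → (d : Fin K → Fin 2) → DeliveryCodes 𝔽 K (point t j) d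

namespace JointChoices

variable {𝔽 : Type u} [Field 𝔽] {K : ℕ} {t : ℝ × ℝ} {F : ℕ}

open Classical in
/-- The placement of the joint scheme. -/
noncomputable def placement (c : JointChoices 𝔽 K t F) : UncodedPlacement K 2 F :=
  fun k i => Finset.univ.filter fun x => ∃ j τ s, k ∈ τ.1 i ∧ c.pos i j τ s = x

/-- The positions of file `i` that are left over by rounding and belong to no subfile. -/
def Leftover (c : JointChoices 𝔽 K t F) (i : Fin 2) : Type :=
  {x : Fin F // ∀ j τ s, c.pos i j τ s ≠ x}

/-- Delivery messages: one per part, and the uncoded left-over symbols of the requested files. -/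
abbrev Message (c : JointChoices 𝔽 K t F) (d : Fin K → Fin 2) : Type u :=
  ((j : Fin 3) → Packets 𝔽 (subSize K t F j)) ×
    ((i : {i : Fin 2 // ∃ k, d k = i}) → c.Leftover i → 𝔽)

/-- The delivery message of the joint scheme. -/
noncomputable def message (c : JointChoices 𝔽 K t F) (d : Fin K → Fin 2) (W : Files 𝔽 2 F) :
    c.Message d :=
  (fun j => deliver (c.codes j d) fun i τ s => W i (c.pos i j τ s), fun i x => W i x.1)

end JointChoices

end CodedCaching

/-!
The converse is a cut-set argument. If only file `i` is requested, then the message, the symbols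
of file `i` cached by a user `u` and the other file determine all files. If `u` requests `i` and
`v` requests `j`, then all files are determined by the message, the symbols of file `i` cached by
`u` and those of file `j` cached by `u` or `v`. In both cases, counting the fibres of the message
bounds its entropy from below by the number of missing symbols (`le_entropy_of_determined`,
`entropy_ge_single`, `entropy_ge_pair`). Since the requests are exchangeable, averaging over the
requests averages the pair bound over all ordered pairs of distinct users (`mixed_average`). A
symbol stored by `s` users then contributes `C(K-1, s) / C(K, s)` or `C(K-2, s) / C(K, s)`; both
sequences are convex and decreasing in `s`, so the average is at least their interpolation at the
average number `t i` of copies of a symbol of file `i` (`le_sum_cuts`). This is the rate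
expression, up to enlarging `t` to total size `K M` and swapping the two files if the less popular
one is cached more, neither of which increases it (`exists_rateBar_le`). For every file size, the
expected rate is therefore at least the minimum over the allocations, which exists because the
rate expression is continuous on a compact set.

For achievability, at an integer point the symmetry between users shows that every user misses the
same number of subfiles in each situation: `S C(K-c, r i) / C(K, r i)` of them are missed by `c`
given users (`numMissing_mul_choose`), and the number of coded packets of a group is the number of
its subfiles missed by a user requesting the file (`encRows_eq`). So a user requesting file `i`
has `S c₁(r i)` unknown packets of its own file and `S c₂(r j)` of the other one, no more than the
rows of the outer MDS code, and an MDS code resolves as many unknowns as it has rows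
(`IsMDS.eq_of_eq_off`, `deliver_decode`). Vandermonde matrices give the codes once the field has
at least `2 · 4 ^ K` elements. The three points of the joint scheme have averages `t`, which makes
memory and the terms for a single requested file exact. The difference of the two terms in the
maximum is `(r 0 - r 1) (K - r 0 - r 1) / (K (K - 1))` at an integer point, and it does not change
sign between the three points (`point_same_side`), so memory sharing also attains the maximum
(`sum_weight_mul_jointRows`). Thus the joint scheme achieves the rate expression at every
allocation (`jointScheme_achieves`), in particular at the minimizers.
-/

namespace CodedCaching

/-! ### Entropy bounds -/

lemma uprob_eq_zero_iff {Ω : Type v} [Fintype Ω] [Nonempty Ω] (E : Set Ω) :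
    uprob E = 0 ↔ E = ∅ := by
  have h : (Fintype.card Ω : ℝ) ≠ 0 := by exact_mod_cast Fintype.card_ne_zero
  simp [uprob, h, Set.ncard_eq_zero (Set.toFinite E)]

lemma uprob_fiber_pos {Ω : Type v} {A : Type w} [Fintype Ω] [Nonempty Ω] (X : Ω → A) (ω : Ω) :
    0 < uprob (X ⁻¹' {X ω}) := by
  have h0 : 0 ≤ uprob (X ⁻¹' {X ω}) := by unfold uprob; positivity
  refine lt_of_le_of_ne h0 fun h => ?_
  have := (uprob_eq_zero_iff _).1 h.symm
  exact (Set.eq_empty_iff_forall_notMem.1 this ω) rfl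

open Classical in
lemma sum_uprob_fiber {Ω : Type v} {A : Type w} [Fintype Ω] [Nonempty Ω] (X : Ω → A) :
    ∑ x ∈ Finset.univ.image X, uprob (X ⁻¹' {x}) = 1 := by
  have h : (Fintype.card Ω : ℝ) ≠ 0 := by exact_mod_cast Fintype.card_ne_zero
  have h1 := Finset.card_eq_sum_card_image X (Finset.univ : Finset Ω)
  simp only [uprob]
  rw [← Finset.sum_div, div_eq_one_iff_eq h, ← Finset.card_univ, h1]
  push_cast
  refine Finset.sum_congr rfl fun x _ => ?_
  rw [Set.ncard_eq_toFinset_card']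
  congr 2
  ext; simp

/-- Entropy is at most the logarithm of the number of values. -/
lemma entropy_le_of_card_image_le {Ω : Type v} {A : Type w} [Fintype Ω] [Nonempty Ω]
    [DecidableEq A] {q : ℕ} (hq : 1 < q) (X : Ω → A) {m : ℕ}
    (h : (Finset.univ.image X).card ≤ q ^ m) : entropy q X ≤ m := by
  have hlq : 0 < Real.log q := Real.log_pos (by exact_mod_cast hq)
  have hn : 0 < ((q : ℝ) ^ m) := by positivity
  have key : ∑ x ∈ Finset.univ.image X, uprob (X ⁻¹' {x}) *
      (-Real.log (uprob (X ⁻¹' {x})) - m * Real.log q) ≤ 0 := by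
    -- Gibbs' inequality against the uniform distribution on `q ^ m` values
    have hle : ∀ x ∈ Finset.univ.image X, uprob (X ⁻¹' {x}) *
        (-Real.log (uprob (X ⁻¹' {x})) - m * Real.log q) ≤
        1 / (q : ℝ) ^ m - uprob (X ⁻¹' {x}) := by
      intro x hx
      obtain ⟨ω, -, rfl⟩ := Finset.mem_image.1 hx
      have hp := uprob_fiber_pos X ω
      set P := uprob (X ⁻¹' {X ω})
      have h1 := Real.log_le_sub_one_of_pos (show 0 < 1 / (P * (q : ℝ) ^ m) by positivity)
      rw [one_div, Real.log_inv, Real.log_mul hp.ne' hn.ne', Real.log_pow] at h1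
      have h2 := mul_le_mul_of_nonneg_left h1 hp.le
      have h3 : P * ((P * (q : ℝ) ^ m)⁻¹ - 1) = 1 / (q : ℝ) ^ m - P := by field_simp
      rw [h3] at h2
      linarith
    refine (Finset.sum_le_sum hle).trans ?_
    rw [Finset.sum_sub_distrib]
    have := sum_uprob_fiber X
    simp only [Finset.sum_const, nsmul_eq_mul]
    have h4 : (∑ x ∈ Finset.univ.image X, uprob (X ⁻¹' {x})) = 1 := by
      convert this
    rw [h4, sub_nonpos, mul_one_div, div_le_one hn]
    exact_mod_cast h
  have h4 : (∑ x ∈ Finset.univ.image X, uprob (X ⁻¹' {x})) = 1 := by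
    convert sum_uprob_fiber X
  have h5 : entropy q X = -∑ x ∈ Finset.univ.image X,
      uprob (X ⁻¹' {x}) * Real.logb q (uprob (X ⁻¹' {x})) := by
    unfold entropy; congr!
  rw [h5]
  have h6 : ∑ x ∈ Finset.univ.image X, uprob (X ⁻¹' {x}) *
      (-Real.log (uprob (X ⁻¹' {x})) - m * Real.log q) =
      (-∑ x ∈ Finset.univ.image X, uprob (X ⁻¹' {x}) * Real.logb q (uprob (X ⁻¹' {x})) - m) *
        Real.log q := by
    have : (m : ℝ) = ∑ x ∈ Finset.univ.image X, uprob (X ⁻¹' {x}) * m := by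
      rw [← Finset.sum_mul, h4, one_mul]
    conv_rhs => rw [this]
    rw [← Finset.sum_neg_distrib, ← Finset.sum_sub_distrib, Finset.sum_mul]
    refine Finset.sum_congr rfl fun x _ => ?_
    rw [Real.logb]
    field_simp
  rw [h6] at key
  have := nonpos_of_mul_nonpos_left key hlq
  linarith

/-- A random variable that is a function of `m` symbols has entropy at most `m`. -/
lemma entropy_le_of_factor {𝔽 : Type u} [Fintype 𝔽] [Nontrivial 𝔽] {Ω : Type v} {A : Type w}
    [Fintype Ω] [Nonempty Ω] {ι : Type*} [Finite ι] {X : Ω → A} (Y : Ω → ι → 𝔽)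
    (h : ∀ ω ω', Y ω = Y ω' → X ω = X ω') : entropy (Fintype.card 𝔽) X ≤ Nat.card ι := by
  classical
  have := Fintype.ofFinite ι
  refine entropy_le_of_card_image_le Fintype.one_lt_card X ?_
  have hs : (Finset.univ.image X).card ≤ (Finset.univ.image Y).card := by
    have hX : ∀ x ∈ Finset.univ.image X, ∃ ω, X ω = x := by simp
    choose! f hf using hX
    refine Finset.card_le_card_of_injOn (fun x => Y (f x)) (fun x _ => by simp) ?_
    intro x hx y hy hxy
    rw [← hf x hx, ← hf y hy]
    exact h _ _ hxy
  refine hs.trans ((Finset.card_le_univ _).trans ?_)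
  rw [Fintype.card_fun, Nat.card_eq_fintype_card]

/-- If no value has probability more than `q ^ (-m)`, the entropy is at least `m`. -/
lemma le_entropy_of_fiber_le {Ω : Type v} {A : Type w} [Fintype Ω] [Nonempty Ω]
    {q : ℕ} (hq : 1 < q) (X : Ω → A) {m : ℕ}
    (h : ∀ ω, (X ⁻¹' {X ω}).ncard * q ^ m ≤ Fintype.card Ω) : (m : ℝ) ≤ entropy q X := by
  classical
  have hq' : (1 : ℝ) < q := by exact_mod_cast hq
  have hc : (0 : ℝ) < Fintype.card Ω := by exact_mod_cast Fintype.card_pos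
  have h4 : (∑ x ∈ Finset.univ.image X, uprob (X ⁻¹' {x})) = 1 := by
    convert sum_uprob_fiber X
  have h5 : entropy q X = -∑ x ∈ Finset.univ.image X,
      uprob (X ⁻¹' {x}) * Real.logb q (uprob (X ⁻¹' {x})) := by
    unfold entropy; congr!
  have : (m : ℝ) = ∑ x ∈ Finset.univ.image X, uprob (X ⁻¹' {x}) * m := by
    rw [← Finset.sum_mul, h4, one_mul]
  rw [h5, this, ← Finset.sum_neg_distrib]
  refine Finset.sum_le_sum fun x hx => ?_
  obtain ⟨ω, -, rfl⟩ := Finset.mem_image.1 hx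
  have hp := uprob_fiber_pos X ω
  rw [← mul_neg]
  refine mul_le_mul_of_nonneg_left ?_ hp.le
  have hle : uprob (X ⁻¹' {X ω}) ≤ ((q : ℝ) ^ m)⁻¹ := by
    rw [uprob, div_le_iff₀ hc, ← div_eq_inv_mul, le_div_iff₀ (by positivity)]
    exact_mod_cast h ω
  have h1 := (Real.logb_le_logb hq' hp (by positivity)).2 hle
  rw [Real.logb_inv, Real.logb_pow, Real.logb_self_eq_one hq', mul_one] at h1
  linarith

/-- If the value of `X` together with the symbols of file `i` at the positions in `T i`, for all
`i`, determines all files, then `X` carries all the remaining symbols. -/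
lemma le_entropy_of_determined {𝔽 : Type u} [Fintype 𝔽] [Nontrivial 𝔽] {N F : ℕ} {B : Type w}
    (X : Files 𝔽 N F → B) (T : Fin N → Finset (Fin F))
    (h : ∀ W W', X W = X W' → (∀ i, ∀ x ∈ T i, W i x = W' i x) → W = W') :
    ∑ i, ((F : ℝ) - (T i).card) ≤ entropy (Fintype.card 𝔽) X := by
  classical
  have hT : ∀ i, (T i).card ≤ F := fun i => by simpa using Finset.card_le_univ (T i)
  have hsum : ∑ i, ((F : ℝ) - (T i).card) = ((∑ i, (F - (T i).card) : ℕ) : ℝ) := by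
    push_cast
    exact Finset.sum_congr rfl fun i _ => by rw [Nat.cast_sub (hT i)]
  rw [hsum]
  refine le_entropy_of_fiber_le Fintype.one_lt_card X fun W₀ => ?_
  let f : (X ⁻¹' {X W₀}) → ((i : Fin N) → {x // x ∈ T i} → 𝔽) := fun W i x => W.1 i x
  have hf : Function.Injective f := by
    intro W W' hW
    refine Subtype.ext (h _ _ (W.2.trans W'.2.symm) fun i x hx => ?_)
    exact congrFun (congrFun hW i) ⟨x, hx⟩
  have h1 : (X ⁻¹' {X W₀}).ncard ≤ Fintype.card 𝔽 ^ ∑ i, (T i).card := by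
    have := Nat.card_le_card_of_injective f hf
    rw [Nat.card_coe_set_eq] at this
    refine this.trans (le_of_eq ?_)
    simp [Nat.card_eq_fintype_card, Finset.prod_pow_eq_pow_sum]
  refine (Nat.mul_le_mul_right _ h1).trans (le_of_eq ?_)
  rw [← pow_add, ← Finset.sum_add_distrib]
  simp [hT, ← pow_mul]
  rw [mul_comm]

/-! ### Decodability -/

/-- Decoding is possible if and only if the requested file is a function of message and cache. -/
lemma decodable_iff {𝔽 : Type u} [Fintype 𝔽] [Nonempty 𝔽] {K N F : ℕ} (A : UncodedPlacement K N F)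
    (d : Fin K → Fin N) {B : Type u} (X : Files 𝔽 N F → B) :
    Decodable A d X ↔ ∀ k W W', X W = X W' → (∀ i, ∀ x ∈ A k i, W i x = W' i x) →
      W (d k) = W' (d k) := by
  classical
  constructor
  · rintro ⟨g, hg⟩ k W W' hX hc
    have hg' : ∀ W, g k (X W) (cache A k W) = W (d k) := fun W => by
      have := Set.eq_empty_iff_forall_notMem.1 ((uprob_eq_zero_iff _).1 (hg k)) W
      simpa using this
    have hcache : cache A k W = cache A k W' := by
      funext i x
      exact hc i x x.2
    rw [← hg' W, ← hg' W', hX, hcache]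
  · intro h
    refine ⟨fun k b z => if hW : ∃ W, X W = b ∧ cache A k W = z then hW.choose (d k)
      else fun _ => Classical.arbitrary 𝔽, fun k => ?_⟩
    rw [uprob_eq_zero_iff, Set.eq_empty_iff_forall_notMem]
    intro W hW
    refine hW ?_
    have hex : ∃ W', X W' = X W ∧ cache A k W' = cache A k W := ⟨W, rfl, rfl⟩
    beta_reduce
    rw [dif_pos hex]
    refine h k _ _ hex.choose_spec.1 fun i x hx => ?_
    exact congrFun (congrFun hex.choose_spec.2 i) ⟨x, hx⟩

/-- The entropy of a cache is the number of its symbols. -/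
lemma entropy_cache {𝔽 : Type u} [Fintype 𝔽] [Nontrivial 𝔽] {K N F : ℕ}
    (A : UncodedPlacement K N F) (k : Fin K) :
    entropy (Fintype.card 𝔽) (cache (𝔽 := 𝔽) A k) = ∑ i, ((A k i).card : ℝ) := by
  classical
  apply le_antisymm
  · have := entropy_le_of_factor (X := cache (𝔽 := 𝔽) A k)
      (ι := Σ i : Fin N, {x : Fin F // x ∈ A k i}) (fun W x => W x.1 x.2)
      (fun W W' h => by
        funext i x
        exact congrFun h ⟨i, x⟩)
    refine this.trans (le_of_eq ?_)
    simp [Nat.card_eq_fintype_card]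
  · have := le_entropy_of_determined (cache (𝔽 := 𝔽) A k) (fun i => (A k i)ᶜ) (by
      intro W W' h1 h2
      funext i x
      by_cases hx : x ∈ A k i
      · exact congrFun (congrFun h1 i) ⟨x, hx⟩
      · exact h2 i x (by simpa using hx))
    refine le_trans (le_of_eq ?_) this
    refine Finset.sum_congr rfl fun i _ => ?_
    rw [Finset.card_compl, Fintype.card_fin,
      Nat.cast_sub (by simpa using Finset.card_le_univ (A k i))]
    ring

/-! ### Counting labels -/

/-- A permutation of the users acts on the labels. -/
def permLabel {K : ℕ} {r : Fin 2 → ℕ} (σ : Equiv.Perm (Fin K)) : Label K r ≃ Label K r where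
  toFun τ := ⟨fun l => (τ.1 l).map σ.toEmbedding, Finset.map_subset_map.2 τ.2.1,
    fun l => (Finset.card_map _).trans (τ.2.2 l)⟩
  invFun τ := ⟨fun l => (τ.1 l).map σ.symm.toEmbedding, Finset.map_subset_map.2 τ.2.1,
    fun l => (Finset.card_map _).trans (τ.2.2 l)⟩
  left_inv τ := by
    refine Subtype.ext (funext fun l => ?_)
    ext x; simp
  right_inv τ := by
    refine Subtype.ext (funext fun l => ?_)
    ext x; simp

lemma mem_permLabel {K : ℕ} {r : Fin 2 → ℕ} (σ : Equiv.Perm (Fin K)) (τ : Label K r) (l : Fin 2)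
    (k : Fin K) : k ∈ (permLabel σ τ).1 l ↔ σ.symm k ∈ τ.1 l := by
  simp only [permLabel, Equiv.coe_fn_mk, Finset.mem_map_equiv]

/-- The number of labels `τ` such that no user in `P` stores the subfile of file `i` with label
`τ`. -/
def numMissing {K : ℕ} (r : Fin 2 → ℕ) (i : Fin 2) (P : Finset (Fin K)) : ℕ :=
  (Finset.univ.filter fun τ : Label K r => Disjoint P (τ.1 i)).card

lemma numMissing_eq_of_card_eq {K : ℕ} (r : Fin 2 → ℕ) (i : Fin 2) {P Q : Finset (Fin K)}
    (h : P.card = Q.card) : numMissing r i P = numMissing r i Q := by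
  obtain ⟨σ, hσ⟩ : ∃ σ : Equiv.Perm (Fin K), P.map σ.toEmbedding = Q := by
    let e : {x // x ∈ P} ≃ {x // x ∈ Q} := Fintype.equivOfCardEq (by simpa using h)
    refine ⟨e.extendSubtype, ?_⟩
    refine Finset.eq_of_subset_of_card_le (fun x hx => ?_) (by simp [h])
    obtain ⟨y, hy, rfl⟩ := Finset.mem_map.1 hx
    exact e.extendSubtype_mem y hy
  refine Finset.card_equiv (permLabel σ) fun τ => ?_
  have : (permLabel σ τ).1 i = (τ.1 i).map σ.toEmbedding := rfl
  simp only [Finset.mem_filter, Finset.mem_univ, true_and, this, ← hσ, Finset.disjoint_map]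

lemma numSub_eq_zero_or {K : ℕ} (r : Fin 2 → ℕ) (i : Fin 2) : numSub K r = 0 ∨ r i ≤ K := by
  refine or_iff_not_imp_left.2 fun h => ?_
  obtain ⟨τ⟩ := Fintype.card_pos_iff.1 (Nat.pos_of_ne_zero h)
  rw [← τ.2.2 i]
  simpa using Finset.card_le_univ (τ.1 i)

/-- By symmetry, all sets of `c` users miss the same number of subfiles; double counting of the
pairs (set of `c` users, label) gives this number. -/
lemma numMissing_mul_choose {K : ℕ} (r : Fin 2 → ℕ) (i : Fin 2) (P : Finset (Fin K)) :
    numMissing r i P * K.choose (r i) = numSub K r * (K - P.card).choose (r i) := by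
  have hPK : P.card ≤ K := by simpa using Finset.card_le_univ P
  have h1 : K.choose P.card * numMissing r i P = numSub K r * (K - r i).choose P.card := by
    have h2 : ∑ Q ∈ Finset.powersetCard P.card (Finset.univ : Finset (Fin K)), numMissing r i Q =
        K.choose P.card * numMissing r i P := by
      rw [Finset.sum_congr rfl fun Q hQ => numMissing_eq_of_card_eq r i
        (Finset.mem_powersetCard.1 hQ).2]
      simp
    rw [← h2]
    simp only [numMissing, Finset.card_filter]
    rw [Finset.sum_comm]
    simp only [← Finset.card_filter]
    rw [Finset.sum_congr rfl (g := fun _ => (K - r i).choose P.card), Finset.sum_const]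
    · simp [numSub]
    · intro τ _
      have : Finset.filter (fun Q => Disjoint Q (τ.1 i)) (Finset.powersetCard P.card Finset.univ) =
          Finset.powersetCard P.card (τ.1 i)ᶜ := by
        ext Q
        simp [Finset.mem_powersetCard, Finset.subset_compl_iff_disjoint_right, and_comm]
      rw [this, Finset.card_powersetCard, Finset.card_compl, Fintype.card_fin, τ.2.2 i]
  rcases numSub_eq_zero_or (K := K) r i with h0 | hr
  · have : numMissing r i P = 0 := by
      have h3 : numMissing r i P ≤ numSub K r := Finset.card_le_univ _
      omega
    rw [this, h0, zero_mul, zero_mul]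
  · have h3 : K.choose P.card * (K - P.card).choose (r i) =
        K.choose (r i) * (K - r i).choose P.card := by
      have h4 := Nat.choose_mul (n := K) (Nat.le_add_right P.card (r i))
      have h5 := Nat.choose_mul (n := K) (Nat.le_add_left (r i) P.card)
      rw [Nat.add_sub_cancel_left] at h4
      rw [Nat.add_sub_cancel] at h5
      rw [← h4, ← h5, Nat.choose_symm_add]
    refine Nat.eq_of_mul_eq_mul_left (Nat.choose_pos hPK) ?_
    calc K.choose P.card * (numMissing r i P * K.choose (r i))
        = (K.choose P.card * numMissing r i P) * K.choose (r i) := by ring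
      _ = numSub K r * (K.choose (r i) * (K - r i).choose P.card) := by rw [h1]; ring
      _ = K.choose P.card * (numSub K r * (K - P.card).choose (r i)) := by rw [← h3]; ring

/-- The division in `share` is exact. -/
lemma numMissing_eq_share {K : ℕ} (r : Fin 2 → ℕ) (i : Fin 2) (P : Finset (Fin K)) :
    numMissing r i P = share K r P.card i := by
  unfold share
  rcases numSub_eq_zero_or (K := K) r i with h0 | hr
  · have h3 : numMissing r i P ≤ numSub K r := Finset.card_le_univ _
    rw [h0] at h3 ⊢
    simpa using h3
  · rw [← numMissing_mul_choose, Nat.mul_div_cancel _ (Nat.choose_pos hr)]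

/-- `share` as an exact quotient. -/
lemma share_mul_choose {K : ℕ} (r : Fin 2 → ℕ) (i : Fin 2) {c : ℕ} (hc : c ≤ K) :
    share K r c i * K.choose (r i) = numSub K r * (K - c).choose (r i) := by
  obtain ⟨P, -, hP⟩ := Finset.exists_subset_card_eq
    (show c ≤ (Finset.univ : Finset (Fin K)).card by simpa using hc)
  rw [← hP, ← numMissing_eq_share, numMissing_mul_choose]

lemma mul_share_one {K : ℕ} (hK : 1 ≤ K) (r : Fin 2 → ℕ) (i : Fin 2) :
    K * share K r 1 i = numSub K r * (K - r i) := by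
  rcases numSub_eq_zero_or (K := K) r i with h0 | hr
  · simp [share, h0]
  · have h := share_mul_choose r i hK
    refine Nat.eq_of_mul_eq_mul_left (Nat.choose_pos hr) ?_
    obtain ⟨n, rfl⟩ : ∃ n, K = n + 1 := ⟨K - 1, by omega⟩
    have h1 := Nat.choose_mul_succ_eq n (r i)
    calc (n + 1).choose (r i) * ((n + 1) * share (n + 1) r 1 i)
        = (n + 1) * (share (n + 1) r 1 i * (n + 1).choose (r i)) := by ring
      _ = numSub (n + 1) r * (n.choose (r i) * (n + 1)) := by
          rw [h, Nat.add_sub_cancel]; ring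
      _ = _ := by rw [h1]; ring

lemma singleRows_eq_share {K : ℕ} (hK : 1 ≤ K) (r : Fin 2 → ℕ) (i : Fin 2) :
    singleRows K r i = share K r 1 i := by
  rw [singleRows, ← mul_share_one hK, Nat.mul_div_cancel_left _ hK]

/-- The number of coded packets of a group is the number of its subfiles that a user requesting
the file misses. -/
lemma encRows_eq {K : ℕ} (r : Fin 2 → ℕ) (d : Fin K → Fin 2) (i : Fin 2)
    (ρ : Fin 2 → Finset (Fin K)) {k : Fin K} (hk : d k = i) :
    encRows K r d i ρ = (Finset.univ.filter fun τ : Group K r d i ρ => k ∉ τ.1.1 i).card := by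
  have hmem : ∀ {x}, x ∈ requesters d i ↔ d x = i := by simp [requesters]
  -- a transposition of two users requesting the file maps the group to itself
  have hsymm : ∀ k' ∈ requesters d i,
      (Finset.univ.filter fun τ : Group K r d i ρ => k' ∉ τ.1.1 i).card =
      (Finset.univ.filter fun τ : Group K r d i ρ => k ∉ τ.1.1 i).card := by
    intro k' hk'
    have hinv : ∀ x ∈ (requesters d i)ᶜ, (Equiv.swap k k').symm x = x := by
      intro x hx
      rw [Finset.mem_compl] at hx
      refine Equiv.swap_apply_of_ne_of_ne ?_ ?_
      · rintro rfl; exact hx (hmem.2 hk)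
      · rintro rfl; exact hx hk'
    have hfix : ∀ (τ : Label K r) l, (permLabel (Equiv.swap k k') τ).1 l ∩ (requesters d i)ᶜ =
        τ.1 l ∩ (requesters d i)ᶜ := by
      intro τ l
      ext x
      simp only [Finset.mem_inter]
      refine and_congr_left fun hx => ?_
      rw [mem_permLabel, hinv x hx]
    refine Finset.card_equiv ((permLabel (Equiv.swap k k')).subtypeEquiv fun τ => ?_) fun τ => ?_
    · simp only [hfix]
    · simp only [Finset.mem_filter, Finset.mem_univ, true_and, Equiv.subtypeEquiv_apply]
      rw [mem_permLabel, Equiv.symm_swap, Equiv.swap_apply_left]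
  have hpos : 0 < (requesters d i).card := Finset.card_pos.2 ⟨k, hmem.2 hk⟩
  rw [encRows]
  refine Nat.div_eq_of_eq_mul_right hpos ?_
  rw [← smul_eq_mul (requesters d i).card, ← Finset.sum_const, ← Finset.sum_congr rfl hsymm]
  simp only [Finset.card_filter]
  rw [Finset.sum_comm]
  simp only [← Finset.card_filter]
  rw [mul_comm, ← Finset.card_univ, ← smul_eq_mul, ← Finset.sum_const]
  refine Finset.sum_congr rfl fun τ _ => ?_
  have h1 := Finset.card_inter_add_card_sdiff (τ.1.1 i) (requesters d i)ᶜ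
  have h2 : τ.1.1 i \ (requesters d i)ᶜ = (requesters d i) ∩ τ.1.1 i := by
    ext x; simp [and_comm]
  have h3 := Finset.card_inter_add_card_sdiff (requesters d i) (τ.1.1 i)
  have h4 : Finset.filter (fun x => x ∉ τ.1.1 i) (requesters d i) = requesters d i \ τ.1.1 i := by
    ext x; simp
  rw [h4]
  rw [τ.2 i, h2, τ.1.2.2 i] at h1
  omega

/-- Summed over all groups of the subfiles of file `i` whose `ρ` satisfies `p`, the number of coded
packets is the number of labels in these groups that a user requesting file `i` misses. -/
lemma sum_encRows {K : ℕ} (r : Fin 2 → ℕ) (d : Fin K → Fin 2) (i : Fin 2)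
    {k : Fin K} (hk : d k = i) (p : (Fin 2 → Finset (Fin K)) → Prop) [DecidablePred p] :
    ∑ ρ with p ρ, encRows K r d i ρ =
      (Finset.univ.filter fun τ : Label K r =>
        p (fun l => τ.1 l ∩ (requesters d i)ᶜ) ∧ k ∉ τ.1 i).card := by
  rw [Finset.card_eq_sum_card_fiberwise (t := Finset.univ.filter p)
    (f := fun (τ : Label K r) l => τ.1 l ∩ (requesters d i)ᶜ)
    (fun τ hτ => by simpa using (Finset.mem_filter.1 hτ).2.1)]
  refine Finset.sum_congr rfl fun ρ hρ => ?_
  rw [encRows_eq r d i ρ hk]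
  refine Finset.card_bij (fun τ _ => τ.1) ?_ (fun _ _ _ _ h => Subtype.ext h) ?_
  · intro τ hτ
    have h1 : (fun l => τ.1.1 l ∩ (requesters d i)ᶜ) = ρ := funext τ.2
    have h2 := (Finset.mem_filter.1 hτ).2
    have h3 := (Finset.mem_filter.1 hρ).2
    simp only [Finset.mem_filter, Finset.mem_univ, true_and, h1]
    exact ⟨⟨h3, h2⟩, trivial⟩
  · intro τ hτ
    simp only [Finset.mem_filter, Finset.mem_univ, true_and] at hτ
    exact ⟨⟨τ, fun l => congrFun hτ.2 l⟩, by simpa using hτ.1.2, rfl⟩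

lemma share_two_le_share_one {K : ℕ} (r : Fin 2 → ℕ) (i : Fin 2) :
    share K r 2 i ≤ share K r 1 i :=
  Nat.div_le_div_right (Nat.mul_le_mul_left _ (Nat.choose_le_choose _ (by omega)))

lemma card_encIdx {K : ℕ} (r : Fin 2 → ℕ) {d : Fin K → Fin 2} (hd : Mixed d) :
    Fintype.card (EncIdx K r d) = share K r 1 0 + share K r 1 1 := by
  have h : ∀ i, ∑ ρ, encRows K r d i ρ = share K r 1 i := by
    intro i
    obtain ⟨k, hk⟩ := hd i
    have := sum_encRows r d i hk (fun _ => True)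
    simp only [Finset.filter_true, true_and] at this
    rw [this, ← Finset.card_singleton k, ← numMissing_eq_share, numMissing]
    congr 1
    ext τ
    simp
  simp [EncIdx, Fintype.card_sigma, h]

/-! ### MDS matrices -/

/-- Vandermonde matrices with distinct nodes are MDS. -/
lemma exists_isMDS (𝔽 : Type u) [Field 𝔽] [Fintype 𝔽] (a : ℕ) (n : Type w) [Fintype n]
    (ha : a ≤ Fintype.card n) (hn : Fintype.card n ≤ Fintype.card 𝔽) :
    ∃ C : Matrix (Fin a) n 𝔽, IsMDS C := by
  obtain ⟨α⟩ := Function.Embedding.nonempty_of_card_le hn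
  refine ⟨fun i j => α j ^ (i : ℕ), by simpa using ha, fun e => ?_⟩
  have : (Matrix.submatrix (fun (i : Fin a) (j : n) => α j ^ (i : ℕ)) id e) =
      (Matrix.vandermonde fun i => α (e i)).transpose := by
    rfl
  rw [this, Matrix.isUnit_iff_isUnit_det, Matrix.det_transpose, isUnit_iff_ne_zero,
    Matrix.det_vandermonde_ne_zero_iff]
  exact α.injective.comp e.injective

/-- An MDS-coded vector is determined by its code word and all but as many entries as the code word
has. -/
lemma IsMDS.eq_of_eq_off {𝔽 : Type u} [Field 𝔽] {m : Type v} {n : Type w} [Fintype m]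
    [DecidableEq m] [Fintype n] {C : Matrix m n 𝔽} (hC : IsMDS C) (U : Finset n)
    (hU : U.card ≤ Fintype.card m) {x y : n → 𝔽} (hoff : ∀ j, j ∉ U → x j = y j)
    (h : ∀ i, ∑ j, C i j * x j = ∑ j, C i j * y j) : x = y := by
  classical
  obtain ⟨T, hUT, -, hT⟩ := Finset.exists_subsuperset_card_eq (Finset.subset_univ U) hU
    (by simpa using hC.1)
  have e : m ≃ T := Fintype.equivOfCardEq (by simp [hT])
  have hunit := hC.2 (e.toEmbedding.trans (Function.Embedding.subtype _))
  have hz : (C.submatrix id (e.toEmbedding.trans (Function.Embedding.subtype _))).mulVec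
      (fun a => x (e a) - y (e a)) = 0 := by
    funext i
    have h1 : ∑ j, C i j * (x j - y j) = 0 := by
      simp only [mul_sub, Finset.sum_sub_distrib, h i, sub_self]
    have h2 : ∑ j ∈ T, C i j * (x j - y j) = ∑ j, C i j * (x j - y j) :=
      Finset.sum_subset (Finset.subset_univ T) fun j _ hj => by
        rw [hoff j fun hjU => hj (hUT hjU), sub_self, mul_zero]
    rw [h1, ← Finset.sum_coe_sort T fun j => C i j * (x j - y j), ← e.sum_comp] at h2
    simpa [Matrix.mulVec, dotProduct] using h2
  have hinj := Matrix.mulVec_injective_of_isUnit hunit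
  have h0 := hinj (hz.trans (Matrix.mulVec_zero _).symm)
  funext j
  by_cases hj : j ∈ T
  · have := congrFun h0 (e.symm ⟨j, hj⟩)
    simpa [sub_eq_zero] using this
  · exact hoff j fun hjU => hj (hUT hjU)

/-! ### Decoding at an integer point -/

section IntegerPoint

variable {𝔽 : Type u} [Field 𝔽] {K : ℕ} {r : Fin 2 → ℕ} {d : Fin K → Fin 2}

open Classical in
/-- The number of packets in the delivery message for the request vector `d`. -/
noncomputable def numRows (K : ℕ) (r : Fin 2 → ℕ) (d : Fin K → Fin 2) : ℕ :=
  if ∀ k, d k = 0 then singleRows K r 0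
  else if ∀ k, d k = 1 then singleRows K r 1
  else jointRows K r

lemma mixed_of_not_const (h0 : ¬ ∀ k, d k = 0) (h1 : ¬ ∀ k, d k = 1) : Mixed d := by
  push Not at h0 h1
  obtain ⟨k0, h0⟩ := h0
  obtain ⟨k1, h1⟩ := h1
  intro i
  fin_cases i
  · exact ⟨k1, by simp; omega⟩
  · exact ⟨k0, by simp; omega⟩

/-- The delivery message consists of `numRows` packets. -/
lemma deliver_eq (c : DeliveryCodes 𝔽 K r d) (b : ℕ) :
    ∃ f : (Fin 2 → Label K r → Fin b → 𝔽) → Fin (numRows K r d) → Fin b → 𝔽,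
      ∀ w, deliver c w = ⟨numRows K r d, f w⟩ := by
  by_cases h0 : ∀ k, d k = 0
  · rw [show numRows K r d = singleRows K r 0 from if_pos h0]
    exact ⟨_, fun w => if_pos h0⟩
  by_cases h1 : ∀ k, d k = 1
  · rw [show numRows K r d = singleRows K r 1 from (if_neg h0).trans (if_pos h1)]
    exact ⟨_, fun w => (if_neg h0).trans (if_pos h1)⟩
  · rw [show numRows K r d = jointRows K r from (if_neg h0).trans (if_neg h1)]
    exact ⟨_, fun w => (if_neg h0).trans (if_neg h1)⟩

lemma packets_eq {𝔽 : Type u} {b n : ℕ} {f g : Fin n → Fin b → 𝔽}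
    (h : (⟨n, f⟩ : Packets 𝔽 b) = ⟨n, g⟩) : f = g :=
  eq_of_heq (Sigma.mk.inj h).2

/-- If only file `i` is requested, every user misses exactly as many of its subfiles as there are
packets. -/
lemma single_decode (hK : 1 ≤ K) (c : DeliveryCodes 𝔽 K r d) (i : Fin 2) {b : ℕ}
    {w w' : Label K r → Fin b → 𝔽} (k : Fin K)
    (h : (fun (a : Fin (singleRows K r i)) s => ∑ τ, c.single i a τ * w τ s) =
      fun a s => ∑ τ, c.single i a τ * w' τ s)
    (hc : ∀ τ : Label K r, k ∈ τ.1 i → w τ = w' τ) : w = w' := by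
  classical
  suffices ∀ s, (fun τ => w τ s) = fun τ => w' τ s by
    funext τ s
    exact congrFun (this s) τ
  intro s
  refine (c.single_mds i).eq_of_eq_off (Finset.univ.filter fun τ => k ∉ τ.1 i) ?_ ?_ fun a =>
    congrFun (congrFun h a) s
  · rw [Fintype.card_fin, singleRows_eq_share hK, ← Finset.card_singleton k,
      ← numMissing_eq_share, numMissing]
    simp only [Finset.disjoint_singleton_left, le_refl]
  · intro τ hτ
    rw [hc τ (by simpa using hτ)]

/-- A user that requests file `i` and misses some subfiles of a group recovers the whole group from
its coded packets. -/
lemma group_decode (hd : Mixed d) (c : DeliveryCodes 𝔽 K r d) {b : ℕ}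
    {w w' : Fin 2 → Label K r → Fin b → 𝔽} (k : Fin K)
    (h : ∀ ρ (a : Fin (encRows K r d (d k) ρ)),
      compressed c w ⟨d k, ρ, a⟩ = compressed c w' ⟨d k, ρ, a⟩)
    (hc : ∀ τ : Label K r, k ∈ τ.1 (d k) → w (d k) τ = w' (d k) τ) : w (d k) = w' (d k) := by
  classical
  funext τ s
  have key : (fun τ' : Group K r d (d k) (fun l => τ.1 l ∩ (requesters d (d k))ᶜ) =>
      w (d k) τ'.1 s) = fun τ' => w' (d k) τ'.1 s := by
    refine (c.enc_mds hd (d k) _).eq_of_eq_off (Finset.univ.filter fun τ' => k ∉ τ'.1.1 (d k)) ?_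
      ?_ fun a => congrFun (h _ a) s
    · rw [Fintype.card_fin, encRows_eq r d (d k) _ rfl]
    · intro τ' hτ'
      rw [hc _ (by simpa using hτ')]
  exact congrFun key ⟨τ, fun l => rfl⟩

/-- If both files are requested, a user recovers all packets of `[W₁*; W₂*]`: it can compute those
packets of the file requested by others whose group it caches entirely, and the message has at
least as many packets as there are remaining ones. -/
lemma joint_decode (hd : Mixed d) (c : DeliveryCodes 𝔽 K r d) {b : ℕ}
    {w w' : Fin 2 → Label K r → Fin b → 𝔽} (k : Fin K)
    (h : (fun (a : Fin (jointRows K r)) s => ∑ e, c.joint a e * compressed c w e s) =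
      fun a s => ∑ e, c.joint a e * compressed c w' e s)
    (hc : ∀ i (τ : Label K r), k ∈ τ.1 i → w i τ = w' i τ) : compressed c w = compressed c w' := by
  classical
  suffices ∀ s, (fun e => compressed c w e s) = fun e => compressed c w' e s by
    funext e s
    exact congrFun (this s) e
  intro s
  refine (c.joint_mds hd).eq_of_eq_off
    (Finset.univ.filter fun e : EncIdx K r d => e.1 = d k ∨ k ∉ e.2.1 e.1) ?_ ?_ fun a =>
    congrFun (congrFun h a) s
  · have h1 : (Finset.univ.filter fun e : EncIdx K r d => e.1 = d k ∨ k ∉ e.2.1 e.1).card =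
        ∑ i, ∑ ρ with (i = d k ∨ k ∉ ρ i), encRows K r d i ρ := by
      rw [Finset.card_filter, Fintype.sum_sigma]
      refine Finset.sum_congr rfl fun i _ => ?_
      rw [Fintype.sum_sigma, Finset.sum_filter]
      refine Finset.sum_congr rfl fun ρ _ => ?_
      by_cases hρ : i = d k ∨ k ∉ ρ i <;> simp [hρ]
    have hown : ∑ ρ with (d k = d k ∨ k ∉ ρ (d k)), encRows K r d (d k) ρ =
        share K r 1 (d k) := by
      rw [sum_encRows r d (d k) rfl, ← Finset.card_singleton k, ← numMissing_eq_share, numMissing]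
      simp
    have hother : ∀ i, i ≠ d k →
        ∑ ρ with (i = d k ∨ k ∉ ρ i), encRows K r d i ρ = share K r 2 i := by
      intro i hi
      obtain ⟨k', hk'⟩ := hd i
      have hne : k ≠ k' := by
        rintro rfl
        exact hi hk'.symm
      have hmem : k ∉ requesters d i := by simpa [requesters] using hi.symm
      have h2 := numMissing_eq_share r i {k, k'}
      rw [Finset.card_pair hne] at h2
      rw [sum_encRows r d i hk', ← h2, numMissing]
      congr 1
      ext τ
      simp [hi, hmem]
    rw [h1, Fintype.card_fin, Fin.sum_univ_two, jointRows]
    have h01 : d k = 0 ∨ d k = 1 := by omega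
    rcases h01 with h0 | h0
    · have e1 := hown
      rw [h0] at e1
      have e2 := hother 1 (by simp [h0])
      rw [h0] at e2 ⊢
      rw [e1, e2]
      exact le_max_right _ _
    · have e1 := hown
      rw [h0] at e1
      have e2 := hother 0 (by simp [h0])
      rw [h0] at e2 ⊢
      rw [e1, e2, add_comm]
      exact le_max_left _ _
  · rintro ⟨i, ρ, a⟩ he
    simp only [Finset.mem_filter, Finset.mem_univ, true_and, not_or, not_not] at he
    refine Finset.sum_congr rfl fun τ _ => ?_
    have hmem : k ∈ τ.1.1 i := by
      have := he.2
      rw [← show _ = ρ i from τ.2 i] at this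
      exact (Finset.mem_inter.1 this).1
    rw [hc i τ.1 hmem]

/-- At an integer point, every user recovers all subfiles of the requested file. -/
lemma deliver_decode (hK : 1 ≤ K) (c : DeliveryCodes 𝔽 K r d) {b : ℕ}
    {w w' : Fin 2 → Label K r → Fin b → 𝔽} (k : Fin K) (h : deliver c w = deliver c w')
    (hc : ∀ i (τ : Label K r), k ∈ τ.1 i → w i τ = w' i τ) : w (d k) = w' (d k) := by
  unfold deliver at h
  split_ifs at h with h0 h1
  · rw [h0 k]
    exact single_decode hK c 0 k (packets_eq h) (hc 0)
  · rw [h1 k]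
    exact single_decode hK c 1 k (packets_eq h) (hc 1)
  · have hd := mixed_of_not_const h0 h1
    have := joint_decode hd c k (packets_eq h) hc
    exact group_decode hd c k (fun ρ a => by rw [this]) (hc (d k))

/-! ### Existence of the codes -/

lemma card_label_le (K : ℕ) (r : Fin 2 → ℕ) : Fintype.card (Label K r) ≤ (2 ^ K) ^ 2 := by
  refine (Fintype.card_subtype_le _).trans ?_
  simp

lemma numSub_eq_card (K : ℕ) (r : Fin 2 → ℕ) : numSub K r = Fintype.card (Label K r) := rfl

lemma share_le_numSub (hK : 1 ≤ K) (r : Fin 2 → ℕ) (i : Fin 2) : share K r 1 i ≤ numSub K r := by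
  rw [← Finset.card_singleton (⟨0, hK⟩ : Fin K), ← numMissing_eq_share]
  exact Finset.card_le_univ _

lemma nonempty_deliveryCodes [Fintype 𝔽] (hK : 1 ≤ K)
    (hq : 2 * (2 ^ K) ^ 2 ≤ Fintype.card 𝔽) (r : Fin 2 → ℕ) (d : Fin K → Fin 2) :
    Nonempty (DeliveryCodes 𝔽 K r d) := by
  have hL := card_label_le K r
  have hs := share_le_numSub hK r
  rw [numSub_eq_card] at hs
  choose S hS using fun i => exists_isMDS 𝔽 (singleRows K r i) (Label K r)
    (by rw [singleRows_eq_share hK]; exact hs i) (by omega)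
  by_cases hd : Mixed d
  · choose E hE using fun i ρ => exists_isMDS 𝔽 (encRows K r d i ρ) (Group K r d i ρ)
      (by
        obtain ⟨k, hk⟩ := hd i
        rw [encRows_eq r d i ρ hk]
        exact Finset.card_le_univ _)
      ((Fintype.card_subtype_le _).trans (by omega))
    obtain ⟨J, hJ⟩ := exists_isMDS 𝔽 (jointRows K r) (EncIdx K r d)
      (by
        rw [card_encIdx r hd]
        have h0 := share_two_le_share_one (K := K) r 0
        have h1 := share_two_le_share_one (K := K) r 1
        exact max_le (by omega) (by omega))
      (by
        rw [card_encIdx r hd]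
        have h0 := hs 0
        have h1 := hs 1
        omega)
    exact ⟨⟨S, hS, E, fun _ => hE, J, fun _ => hJ⟩⟩
  · exact ⟨⟨S, hS, fun _ _ => 0, fun h => absurd h hd, 0, fun h => absurd h hd⟩⟩

end IntegerPoint

/-! ### The rate expression -/

lemma ratio_zero_one {K : ℕ} (hK : 1 ≤ K) {n : ℕ} (hn : n ≤ K) :
    ratio K 1 n = ((K : ℝ) - n) / K := by
  have hc : (0 : ℝ) < K.choose n := by exact_mod_cast Nat.choose_pos hn
  have hK0 : (0 : ℝ) < K := by exact_mod_cast hK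
  obtain ⟨m, rfl⟩ : ∃ m, K = m + 1 := ⟨K - 1, by omega⟩
  have h1 : binom (((m + 1 : ℕ) : ℤ) - 1) n = m.choose n := by
    unfold binom
    split_ifs with h
    · simp
    · rw [Nat.choose_eq_zero_of_lt (by push_cast at h; omega)]
  have h2 : binom ((m + 1 : ℕ) : ℤ) n = (m + 1).choose n := by
    unfold binom
    rw [if_pos ⟨by omega, by omega⟩]
    simp
  rw [ratio, h1, h2, div_eq_div_iff hc.ne' hK0.ne']
  have := Nat.choose_mul_succ_eq m n
  rw [← Nat.cast_sub hn]
  rw [mul_comm _ (((m + 1).choose n : ℕ) : ℝ)]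
  exact_mod_cast this

lemma ratio_eq_choose {K c n : ℕ} (hc : c ≤ K) (hn : n ≤ K) :
    ratio K c n = ((K - c).choose n : ℝ) / K.choose n := by
  have h1 : binom ((K : ℤ) - c) n = (K - c).choose n := by
    unfold binom
    split_ifs with h
    · congr 1
      omega
    · rw [Nat.choose_eq_zero_of_lt (by omega)]
  have h2 : binom (K : ℤ) n = K.choose n := by
    unfold binom
    rw [if_pos ⟨by omega, by omega⟩]
    simp
  rw [ratio, h1, h2]

/-- For `K = 1` both sides are zero. -/
lemma ratio_two {K : ℕ} (hK : 1 ≤ K) {n : ℕ} (hn : n ≤ K) :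
    ratio K 2 n = ((K : ℝ) - n) * (K - n - 1) / (K * (K - 1)) := by
  have hc : (0 : ℝ) < K.choose n := by exact_mod_cast Nat.choose_pos hn
  rcases hK.eq_or_lt with rfl | hK2
  · have : binom (((1 : ℕ) : ℤ) - 2) n = 0 := by
      unfold binom
      rw [if_neg (by omega)]
    rw [ratio, this]
    simp
  obtain ⟨m, rfl⟩ : ∃ m, K = m + 2 := ⟨K - 2, by omega⟩
  rw [show (2 : ℤ) = ((2 : ℕ) : ℤ) from rfl, ratio_eq_choose (by omega) hn,
    Nat.add_sub_cancel, div_eq_div_iff hc.ne'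
      (by push_cast; rw [show (m : ℝ) + 2 - 1 = m + 1 by ring]; positivity)]
  have h1 := Nat.choose_mul_succ_eq m n
  have h2 := Nat.choose_mul_succ_eq (m + 1) n
  by_cases hn1 : n ≤ m + 1
  · have h1' : (m.choose n : ℝ) * (m + 1) = (m + 1).choose n * (m + 1 - n) := by
      have : ((m + 1 - n : ℕ) : ℝ) = (m : ℝ) + 1 - n := by rw [Nat.cast_sub hn1]; push_cast; ring
      rw [← this]
      exact_mod_cast h1
    have h2' : ((m + 1).choose n : ℝ) * (m + 2) = (m + 2).choose n * (m + 2 - n) := by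
      have : ((m + 2 - n : ℕ) : ℝ) = (m : ℝ) + 2 - n := by rw [Nat.cast_sub hn]; push_cast; ring
      rw [← this]
      exact_mod_cast h2
    push_cast
    linear_combination (m + 2 : ℝ) * h1' + (m + 1 - n : ℝ) * h2'
  · obtain rfl : n = m + 2 := by omega
    rw [Nat.choose_eq_zero_of_lt (by omega)]
    push_cast
    ring

lemma interp_one {K : ℕ} (hK : 1 ≤ K) {t : ℝ} (h0 : 0 ≤ t) (ht : t ≤ K) :
    interp K 1 t = (K - t) / K := by
  have hK0 : (K : ℝ) ≠ 0 := by positivity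
  obtain ⟨n, hn⟩ := Int.eq_ofNat_of_zero_le (Int.floor_nonneg.2 h0)
  have hle : (n : ℝ) ≤ t := by have := Int.floor_le t; rw [hn] at this; exact_mod_cast this
  have hlt : t < n + 1 := by have := Int.lt_floor_add_one t; rw [hn] at this; exact_mod_cast this
  have hnK : n ≤ K := by exact_mod_cast hle.trans ht
  unfold interp
  rw [hn, ratio_zero_one hK hnK]
  push_cast
  rcases hnK.lt_or_eq with h | rfl
  · rw [show (n : ℤ) + 1 = ((n + 1 : ℕ) : ℤ) by push_cast; rfl, ratio_zero_one hK h]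
    push_cast
    field_simp
    ring
  · obtain rfl : t = n := le_antisymm ht hle
    simp

/-- On `[n, n + 1]` the interpolation is the chord of `n ↦ (K - n) (K - n - 1) / (K (K - 1))`. -/
lemma interp_two_eq_line {K : ℕ} (hK : 1 ≤ K) {t : ℝ} (h0 : 0 ≤ t) (ht : t ≤ K) :
    interp K 2 t = ((K : ℝ) - ⌊t⌋ - 1) * (K + ⌊t⌋ - 2 * t) / (K * (K - 1)) := by
  obtain ⟨n, hn⟩ := Int.eq_ofNat_of_zero_le (Int.floor_nonneg.2 h0)
  have hle : (n : ℝ) ≤ t := by have := Int.floor_le t; rw [hn] at this; exact_mod_cast this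
  have hnK : n ≤ K := by exact_mod_cast hle.trans ht
  unfold interp
  rw [hn, ratio_two hK hnK]
  push_cast
  rcases hnK.lt_or_eq with h | rfl
  · rw [show (n : ℤ) + 1 = ((n + 1 : ℕ) : ℤ) by push_cast; rfl, ratio_two hK h]
    push_cast
    ring
  · obtain rfl : t = n := le_antisymm ht hle
    ring

/-- On `[0, K]` the interpolation differs from a polynomial by a multiple of
`Int.fract t * (1 - Int.fract t)`, which is continuous. -/
lemma continuousOn_interp_two {K : ℕ} (hK : 1 ≤ K) :
    ContinuousOn (interp K 2) (Set.Icc 0 (K : ℝ)) := by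
  have h1 : Continuous ((fun x : ℝ => x * (1 - x)) ∘ Int.fract) :=
    ContinuousOn.comp_fract'' (by fun_prop) (by norm_num)
  have h2 : Continuous fun t : ℝ => (((K : ℝ) - t) * (K - t - 1) +
      ((fun x : ℝ => x * (1 - x)) ∘ Int.fract) t) / (K * (K - 1)) := by fun_prop
  refine h2.continuousOn.congr fun t ht => ?_
  rw [interp_two_eq_line hK ht.1 ht.2]
  simp only [Function.comp, Int.fract]
  congr 1
  ring

lemma continuousOn_interp_one {K : ℕ} (hK : 1 ≤ K) :
    ContinuousOn (interp K 1) (Set.Icc 0 (K : ℝ)) := by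
  have h2 : Continuous fun t : ℝ => ((K : ℝ) - t) / K := by fun_prop
  exact h2.continuousOn.congr fun t ht => interp_one hK ht.1 ht.2

lemma isCompact_allocations (K : ℕ) (M : ℝ) : IsCompact (allocations K M) := by
  refine Metric.isCompact_of_isClosed_isBounded ?_ ?_
  · unfold allocations
    simp only [Set.ofPred_and]
    refine (isClosed_le ?_ ?_).inter ((isClosed_le ?_ ?_).inter ((isClosed_le ?_ ?_).inter
      (isClosed_eq ?_ ?_))) <;> fun_prop
  · refine (Metric.isBounded_Icc ((0, 0) : ℝ × ℝ) (K, K)).subset fun t ht => ?_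
    obtain ⟨h1, h2, h3, -⟩ := ht
    exact ⟨⟨h1.trans h2, h1⟩, ⟨h3, h2.trans h3⟩⟩

lemma continuousOn_rateBar {K : ℕ} (hK : 1 ≤ K) (p : Fin 2 → ℝ) (M : ℝ) :
    ContinuousOn (rateBar K p) (allocations K M) := by
  have m1 : Set.MapsTo Prod.fst (allocations K M) (Set.Icc 0 (K : ℝ)) :=
    fun t ht => ⟨ht.1.trans ht.2.1, ht.2.2.1⟩
  have m2 : Set.MapsTo Prod.snd (allocations K M) (Set.Icc 0 (K : ℝ)) :=
    fun t ht => ⟨ht.1, ht.2.1.trans ht.2.2.1⟩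
  have a1 := (continuousOn_interp_one hK).comp continuousOn_fst m1
  have a2 := (continuousOn_interp_one hK).comp continuousOn_snd m2
  have b1 := (continuousOn_interp_two hK).comp continuousOn_fst m1
  have b2 := (continuousOn_interp_two hK).comp continuousOn_snd m2
  unfold rateBar
  refine ContinuousOn.add (Continuous.continuousOn (by fun_prop)) ?_
  exact continuousOn_const.mul (ContinuousOn.sup (a1.add b2) (b1.add a2))

/-! ### The three integer points of the joint scheme -/

/-- Averaging over the three integer points interpolates linearly in each coordinate. -/
lemma sum_weight_mul (t : ℝ × ℝ) (l : Fin 2) (φ : ℕ → ℝ) :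
    ∑ j, weight t j * φ (point t j l) =
      (1 + (⌊![t.1, t.2] l⌋₊ : ℝ) - ![t.1, t.2] l) * φ ⌊![t.1, t.2] l⌋₊ +
      (![t.1, t.2] l - (⌊![t.1, t.2] l⌋₊ : ℝ)) * φ (⌊![t.1, t.2] l⌋₊ + 1) := by
  simp only [weight, point, sharing, Fin.sum_univ_three]
  split_ifs with h <;> fin_cases l <;> simp <;> try ring1
  rw [← h]
  ring

lemma sum_weight (t : ℝ × ℝ) : ∑ j, weight t j = 1 := by
  have := sum_weight_mul t 0 (fun _ => 1)
  simp only [mul_one] at this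
  rw [this]
  ring

lemma sum_weight_mul_point (t : ℝ × ℝ) (l : Fin 2) :
    ∑ j, weight t j * (point t j l : ℝ) = ![t.1, t.2] l := by
  rw [sum_weight_mul t l (fun n => (n : ℝ))]
  push_cast
  ring

lemma sum_weight_mul_ratio {K : ℕ} {t : ℝ × ℝ} (l : Fin 2) (c : ℤ)
    (h : 0 ≤ ![t.1, t.2] l) :
    ∑ j, weight t j * ratio K c (point t j l) = interp K c (![t.1, t.2] l) := by
  have hz : ⌊![t.1, t.2] l⌋ = (⌊![t.1, t.2] l⌋₊ : ℤ) := (Int.natCast_floor_eq_floor h).symm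
  rw [sum_weight_mul t l (fun n => ratio K c n), interp, hz]
  push_cast
  ring

lemma weight_nonneg {t : ℝ × ℝ} (h2 : 0 ≤ t.2) (h12 : t.2 ≤ t.1) (j : Fin 3) :
    0 ≤ weight t j := by
  have e1 := Nat.floor_le (h2.trans h12)
  have e2 := Nat.floor_le h2
  have e3 := Nat.lt_floor_add_one t.1
  have e4 := Nat.lt_floor_add_one t.2
  simp only [weight, sharing]
  split_ifs with h h' <;> [rw [h] at e1 e3; skip; skip] <;> fin_cases j <;> simp <;>
    first | linarith | (rw [h]; linarith)

/-- Points of positive weight are admissible: some label exists. -/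
lemma point_le {K : ℕ} {t : ℝ × ℝ} (h2 : 0 ≤ t.2) (h12 : t.2 ≤ t.1) (hK : t.1 ≤ K) (j : Fin 3)
    (hj : weight t j ≠ 0) : point t j 1 ≤ point t j 0 ∧ point t j 0 ≤ K := by
  have e1 := Nat.floor_le (h2.trans h12)
  have e2 := Nat.floor_le h2
  have e3 := Nat.lt_floor_add_one t.1
  have e4 := Nat.lt_floor_add_one t.2
  have hfl : ⌊t.2⌋₊ ≤ ⌊t.1⌋₊ := Nat.floor_mono h12
  have hflK : ⌊t.1⌋₊ ≤ K := by exact_mod_cast e1.trans hK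
  -- an integer part can only equal `K` if the fractional part vanishes
  have hlt : t.1 ≠ ⌊t.1⌋₊ → ⌊t.1⌋₊ + 1 ≤ K := by
    intro hne
    have : (⌊t.1⌋₊ : ℝ) < K := (lt_of_le_of_ne e1 hne.symm).trans_le hK
    exact_mod_cast this
  have hj' := lt_of_le_of_ne (weight_nonneg h2 h12 j) hj.symm
  clear hj
  revert hj'
  simp only [weight, point, sharing]
  rcases eq_or_ne t.1 ⌊t.1⌋₊ with he | he <;> [skip; have := hlt he] <;>
    split_ifs with h h' <;> [rw [← h] at e2 e4 ⊢; skip; skip; rw [← h] at e2 e4 ⊢; skip; skip] <;>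
    fin_cases j <;> simp <;> intro hj <;> first | omega | (exfalso; linarith)

/-- The three points lie on the same side of the line `r₁ + r₂ = K`, up to points on the diagonal.
Hence the same term of the maximum in the rate is largest at all of them. -/
lemma point_same_side (K : ℕ) {t : ℝ × ℝ} (h12 : t.2 ≤ t.1) :
    (∀ j, point t j 1 < point t j 0 → point t j 0 + point t j 1 ≤ K) ∨
      (∀ j, point t j 1 < point t j 0 → K ≤ point t j 0 + point t j 1) := by
  have hfl : ⌊t.2⌋₊ ≤ ⌊t.1⌋₊ := Nat.floor_mono h12
  simp only [point, sharing]
  split_ifs with h h' <;> simp [Fin.forall_fin_succ] <;> omega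

lemma numSub_pos {K : ℕ} {r : Fin 2 → ℕ} (h : r 1 ≤ r 0) (hK : r 0 ≤ K) : 0 < numSub K r := by
  obtain ⟨τ0, -, h0⟩ := Finset.exists_subset_card_eq
    (show r 0 ≤ (Finset.univ : Finset (Fin K)).card by simpa using hK)
  obtain ⟨τ1, h10, h1⟩ := Finset.exists_subset_card_eq (show r 1 ≤ τ0.card by omega)
  exact Fintype.card_pos_iff.2 ⟨![τ0, τ1], h10, by simp [Fin.forall_fin_two, h0, h1]⟩

lemma share_div {K : ℕ} {r : Fin 2 → ℕ} (i : Fin 2) {c : ℕ} (hc : c ≤ K)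
    (hS : numSub K r ≠ 0) : (share K r c i : ℝ) / numSub K r = ratio K c (r i) := by
  have hr := (numSub_eq_zero_or r i).resolve_left hS
  have hS' : (numSub K r : ℝ) ≠ 0 := by exact_mod_cast hS
  have hch : (K.choose (r i) : ℝ) ≠ 0 := by exact_mod_cast (Nat.choose_pos hr).ne'
  rw [ratio_eq_choose hc hr, div_eq_div_iff hS' hch]
  have := share_mul_choose r i hc
  rw [mul_comm _ (numSub K r : ℝ)]
  exact_mod_cast this

lemma singleRows_div {K : ℕ} (hK : 1 ≤ K) {r : Fin 2 → ℕ} (i : Fin 2) (hS : numSub K r ≠ 0) :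
    (singleRows K r i : ℝ) / numSub K r = (K - r i) / K := by
  rw [singleRows_eq_share hK, share_div i hK hS,
    ← ratio_zero_one hK ((numSub_eq_zero_or r i).resolve_left hS)]
  rfl

/-- Time sharing loses nothing in the case where both files are requested. -/
lemma sum_weight_mul_jointRows {K : ℕ} (hK : 2 ≤ K) {t : ℝ × ℝ} (h2 : 0 ≤ t.2) (h12 : t.2 ≤ t.1)
    (htK : t.1 ≤ K) :
    ∑ j, weight t j * ((jointRows K (point t j) : ℝ) / numSub K (point t j)) ≤
      max (interp K 1 t.1 + interp K 2 t.2) (interp K 2 t.1 + interp K 1 t.2) := by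
  have hK1 : 1 ≤ K := by omega
  have hKr : (2 : ℝ) ≤ K := by exact_mod_cast hK
  have h1 : 0 ≤ t.1 := h2.trans h12
  have g : ∀ l : Fin 2, 0 ≤ ![t.1, t.2] l := by simp [Fin.forall_fin_two, h1, h2]
  have e1 : ∑ j, weight t j * (ratio K 1 (point t j 0) + ratio K 2 (point t j 1)) =
      interp K 1 t.1 + interp K 2 t.2 := by
    simp only [mul_add, Finset.sum_add_distrib, sum_weight_mul_ratio _ _ (g _)]
    simp
  have e2 : ∑ j, weight t j * (ratio K 2 (point t j 0) + ratio K 1 (point t j 1)) =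
      interp K 2 t.1 + interp K 1 t.2 := by
    simp only [mul_add, Finset.sum_add_distrib, sum_weight_mul_ratio _ _ (g _)]
    simp
  -- the common sign of the difference of the two terms
  have hdiff : ∀ j, weight t j ≠ 0 →
      (ratio K 1 (point t j 0) + ratio K 2 (point t j 1)) -
      (ratio K 2 (point t j 0) + ratio K 1 (point t j 1)) =
      ((point t j 0 : ℝ) - point t j 1) * (K - point t j 0 - point t j 1) / (K * (K - 1)) := by
    intro j hj
    obtain ⟨a, b⟩ := point_le h2 h12 htK j hj
    rw [ratio_zero_one hK1 b, ratio_zero_one hK1 (a.trans b), ratio_two hK1 b,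
      ratio_two hK1 (a.trans b)]
    have : (K : ℝ) - 1 ≠ 0 := by linarith
    field_simp
    ring
  have hrow : ∀ j, weight t j ≠ 0 →
      (jointRows K (point t j) : ℝ) / numSub K (point t j) =
      max (ratio K 1 (point t j 0) + ratio K 2 (point t j 1))
        (ratio K 2 (point t j 0) + ratio K 1 (point t j 1)) := by
    intro j hj
    obtain ⟨a, b⟩ := point_le h2 h12 htK j hj
    have hS := (numSub_pos a b).ne'
    have s1 := fun i => share_div i hK1 hS
    have s2 := fun i => share_div i hK hS
    rw [jointRows, Nat.cast_max, max_comm, ← max_div_div_right (by positivity)]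
    push_cast at s1 s2 ⊢
    rw [add_div, add_div, s1, s2, s1, s2, add_comm (ratio K 1 (point t j 1))]
  have hden : (0 : ℝ) < K * (K - 1) := by nlinarith
  rw [← e1, ← e2]
  rcases point_same_side K h12 with hs | hs
  · refine le_max_of_le_left (Finset.sum_le_sum fun j _ => ?_)
    by_cases hj : weight t j = 0
    · simp [hj]
    rw [hrow j hj, max_eq_left]
    rw [← sub_nonneg, hdiff j hj]
    refine div_nonneg ?_ hden.le
    obtain ⟨a, b⟩ := point_le h2 h12 htK j hj
    rcases a.lt_or_eq with a | a
    · have h3 : ((point t j 0 : ℝ) + point t j 1) ≤ K := by exact_mod_cast hs j a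
      have h4 : (point t j 1 : ℝ) ≤ point t j 0 := by exact_mod_cast a.le
      exact mul_nonneg (by linarith) (by linarith)
    · rw [a]; simp
  · refine le_max_of_le_right (Finset.sum_le_sum fun j _ => ?_)
    by_cases hj : weight t j = 0
    · simp [hj]
    rw [hrow j hj, max_eq_right]
    rw [← sub_nonpos, hdiff j hj]
    refine div_nonpos_of_nonpos_of_nonneg ?_ hden.le
    obtain ⟨a, b⟩ := point_le h2 h12 htK j hj
    rcases a.lt_or_eq with a | a
    · have h3 : (K : ℝ) ≤ ((point t j 0 : ℝ) + point t j 1) := by exact_mod_cast hs j a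
      have h4 : (point t j 1 : ℝ) ≤ point t j 0 := by exact_mod_cast a.le
      exact mul_nonpos_of_nonneg_of_nonpos (by linarith) (by linarith)
    · rw [a]; simp

/-! ### Existence of the joint scheme -/

lemma sum_Iic_weight (t : ℝ × ℝ) (j : Fin 3) :
    ∑ l ∈ Finset.Iic j, weight t l = ∑ l ∈ Finset.Iio j, weight t l + weight t j := by
  rw [← Finset.Iio_insert, Finset.sum_insert (by simp), add_comm]

lemma numSub_mul_subSize_le {K : ℕ} {t : ℝ × ℝ} (h2 : 0 ≤ t.2) (h12 : t.2 ≤ t.1) (F : ℕ)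
    (j : Fin 3) : (numSub K (point t j) : ℝ) * subSize K t F j ≤ weight t j * F := by
  have hw := weight_nonneg h2 h12 j
  rcases (numSub K (point t j)).eq_zero_or_pos with h | h
  · rw [h]
    simp only [Nat.cast_zero, zero_mul]
    positivity
  · have hS : (0 : ℝ) < numSub K (point t j) := by exact_mod_cast h
    rw [mul_comm, ← le_div_iff₀ hS]
    exact Nat.floor_le (by positivity)

/-- The three parts fit into a file: a block of `m` symbols with `m ≤ θ_j F` fits into part `j`,
starting at its first position. -/
lemma nonempty_jointChoices {𝔽 : Type u} [Field 𝔽] [Fintype 𝔽] {K : ℕ} (hK : 1 ≤ K)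
    (hq : 2 * (2 ^ K) ^ 2 ≤ Fintype.card 𝔽) {t : ℝ × ℝ} (h2 : 0 ≤ t.2) (h12 : t.2 ≤ t.1) (F : ℕ) :
    Nonempty (JointChoices 𝔽 K t F) := by
  have hw := weight_nonneg h2 h12
  have hcard : ∀ j, Fintype.card (Label K (point t j) × Fin (subSize K t F j)) =
      numSub K (point t j) * subSize K t F j := fun j => by
    rw [Fintype.card_prod, Fintype.card_fin]; rfl
  let e := fun j => Fintype.equivFinOfCardEq (hcard j)
  let s := fun j : Fin 3 => (∑ l ∈ Finset.Iio j, weight t l) * F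
  have hs : ∀ j, 0 ≤ s j := fun j =>
    mul_nonneg (Finset.sum_nonneg fun l _ => hw l) (Nat.cast_nonneg _)
  have hle : ∀ j (a : Fin (numSub K (point t j) * subSize K t F j)),
      ((⌊s j⌋₊ + a : ℕ) : ℝ) + 1 ≤ (∑ l ∈ Finset.Iic j, weight t l) * F := by
    intro j a
    have e1 := Nat.floor_le (hs j)
    have e2 := numSub_mul_subSize_le (K := K) h2 h12 F j
    have e3 : ((a : ℕ) : ℝ) + 1 ≤ numSub K (point t j) * subSize K t F j := by
      exact_mod_cast a.2
    rw [sum_Iic_weight, add_mul]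
    change _ ≤ s j + _
    push_cast
    linarith
  have hlt : ∀ j (a : Fin (numSub K (point t j) * subSize K t F j)), ⌊s j⌋₊ + a < F := by
    intro j a
    have e1 : ∑ l ∈ Finset.Iic j, weight t l ≤ 1 := by
      rw [← sum_weight t]
      exact Finset.sum_le_univ_sum_of_nonneg hw
    have e2 := (hle j a).trans (mul_le_mul_of_nonneg_right e1 (Nat.cast_nonneg F))
    rw [one_mul] at e2
    have : ⌊s j⌋₊ + a + 1 ≤ F := by exact_mod_cast e2
    omega
  refine ⟨⟨fun _ j τ b => ⟨⌊s j⌋₊ + e j (τ, b), hlt j _⟩, ?_, ?_, ?_, fun j d =>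
    (nonempty_deliveryCodes hK hq _ d).some⟩⟩
  · intro _ j τ b τ' b' h
    have h1 : (e j (τ, b) : ℕ) = e j (τ', b') := by
      have := Fin.mk.inj_iff.1 h
      omega
    simpa using (e j).injective (Fin.ext h1)
  · intro _ j τ b
    refine (Nat.lt_floor_add_one (s j)).trans_le ?_
    push_cast
    have : (0 : ℝ) ≤ ((e j (τ, b) : ℕ) : ℝ) := Nat.cast_nonneg _
    linarith
  · intro _ j τ b
    exact hle j _

/-! ### Expectations over the requests -/

lemma sum_prob {K : ℕ} {p : Fin 2 → ℝ} (hp : p 0 + p 1 = 1) :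
    ∑ d : Fin K → Fin 2, ∏ k, p (d k) = 1 := by
  rw [← Fintype.piFinset_univ, ← Finset.prod_univ_sum]
  simp [hp]

open Classical in
/-- Expectation of a function of the requests that depends only on the set of requested files. -/
lemma sum_prob_mul {K : ℕ} (hK : 1 ≤ K) {p : Fin 2 → ℝ} (hp : p 0 + p 1 = 1) (a b c : ℝ) :
    ∑ d : Fin K → Fin 2, (∏ k, p (d k)) *
        (if ∀ k, d k = 0 then a else if ∀ k, d k = 1 then b else c) =
      p 0 ^ K * a + p 1 ^ K * b + (1 - p 0 ^ K - p 1 ^ K) * c := by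
  have h : ∀ d : Fin K → Fin 2, (∏ k, p (d k)) *
      (if ∀ k, d k = 0 then a else if ∀ k, d k = 1 then b else c) =
      (∏ k, p (d k)) * c + (if d = fun _ => 0 then (∏ k, p (d k)) * (a - c) else 0) +
      (if d = fun _ => 1 then (∏ k, p (d k)) * (b - c) else 0) := by
    intro d
    have e0 : (d = fun _ => 0) ↔ ∀ k, d k = 0 := funext_iff
    have e1 : (d = fun _ => 1) ↔ ∀ k, d k = 1 := funext_iff
    simp only [e0, e1]
    split_ifs with h0 h1
    · have := h0 ⟨0, hK⟩
      rw [h1 ⟨0, hK⟩] at this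
      simp at this
    all_goals ring
  simp only [h, Finset.sum_add_distrib, ← Finset.sum_mul, sum_prob hp, Finset.sum_ite_eq',
    Finset.mem_univ, if_true, Finset.prod_const, Finset.card_univ, Fintype.card_fin]
  ring

lemma mixed_prob_nonneg {K : ℕ} (hK : 1 ≤ K) {p : Fin 2 → ℝ} (h0 : 0 ≤ p 0) (h1 : 0 ≤ p 1)
    (hp : p 0 + p 1 = 1) : 0 ≤ 1 - p 0 ^ K - p 1 ^ K := by
  have e0 := pow_le_of_le_one h0 (by linarith) (show K ≠ 0 by omega)
  have e1 := pow_le_of_le_one h1 (by linarith) (show K ≠ 0 by omega)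
  linarith

/-! ### Performance of the joint scheme -/

namespace JointChoices

variable {𝔽 : Type u} [Field 𝔽] {K : ℕ} {t : ℝ × ℝ} {F : ℕ}

/-- The symbols of all subfiles of a file: a part, a label and an index. -/
abbrev Cell (K : ℕ) (t : ℝ × ℝ) (F : ℕ) : Type :=
  Σ j : Fin 3, Label K (point t j) × Fin (subSize K t F j)

/-- The position of a cell in file `i`. -/
def cellPos (c : JointChoices 𝔽 K t F) (i : Fin 2) (x : Cell K t F) : Fin F :=
  c.pos i x.1 x.2.1 x.2.2

/-- Different parts of a file are disjoint. -/
lemma not_pos_eq_of_lt (h2 : 0 ≤ t.2) (h12 : t.2 ≤ t.1) (c : JointChoices 𝔽 K t F) (i : Fin 2)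
    {j j' : Fin 3} (hj : j < j') (τ s τ' s') : c.pos i j τ s ≠ c.pos i j' τ' s' := by
  intro h
  have e1 := c.pos_le i j τ s
  have e2 := c.lt_pos i j' τ' s'
  have e3 : ∑ l ∈ Finset.Iic j, weight t l ≤ ∑ l ∈ Finset.Iio j', weight t l := by
    refine Finset.sum_le_sum_of_subset_of_nonneg (fun l hl => ?_)
      fun l _ _ => weight_nonneg h2 h12 l
    exact Finset.mem_Iio.2 ((Finset.mem_Iic.1 hl).trans_lt hj)
  have e4 := mul_le_mul_of_nonneg_right e3 (Nat.cast_nonneg (α := ℝ) F)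
  rw [h] at e1
  linarith

lemma cellPos_injective (h2 : 0 ≤ t.2) (h12 : t.2 ≤ t.1) (c : JointChoices 𝔽 K t F) (i : Fin 2) :
    Function.Injective (c.cellPos i) := by
  rintro ⟨j, τ, s⟩ ⟨j', τ', s'⟩ h
  rcases lt_trichotomy j j' with hj | rfl | hj
  · exact absurd h (c.not_pos_eq_of_lt h2 h12 i hj _ _ _ _)
  · obtain ⟨rfl, rfl⟩ := c.pos_inj _ _ _ _ _ _ h
    rfl
  · exact absurd h.symm (c.not_pos_eq_of_lt h2 h12 i hj _ _ _ _)

instance (c : JointChoices 𝔽 K t F) (i : Fin 2) : Finite (c.Leftover i) :=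
  inferInstanceAs (Finite {x : Fin F // ∀ j τ s, c.pos i j τ s ≠ x})

lemma card_cell : Fintype.card (Cell K t F) =
    ∑ j, numSub K (point t j) * subSize K t F j := by
  simp [Fintype.card_sigma, numSub]

lemma card_leftover (h2 : 0 ≤ t.2) (h12 : t.2 ≤ t.1) (c : JointChoices 𝔽 K t F) (i : Fin 2) :
    Nat.card (c.Leftover i) + ∑ j, numSub K (point t j) * subSize K t F j = F := by
  classical
  have h1 : Nat.card (c.Leftover i) = ((Finset.univ.image (c.cellPos i))ᶜ).card := by
    rw [← Nat.card_eq_finsetCard]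
    refine Nat.card_congr (Equiv.subtypeEquivRight fun x => ?_)
    simp [cellPos]
  have h3 : (Finset.univ.image (c.cellPos i)).card = Fintype.card (Cell K t F) :=
    Finset.card_image_of_injective _ (c.cellPos_injective h2 h12 i)
  have h4 := Finset.card_compl_add_card (Finset.univ.image (c.cellPos i))
  rw [h3, card_cell, Fintype.card_fin] at h4
  rw [h1, h4]

/-- The number of left-over symbols is bounded independently of the file size. -/
lemma card_leftover_le (h2 : 0 ≤ t.2) (h12 : t.2 ≤ t.1) (hK : t.1 ≤ K)
    (c : JointChoices 𝔽 K t F) (i : Fin 2) :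
    (Nat.card (c.Leftover i) : ℝ) ≤ (∑ j, (numSub K (point t j) : ℝ)) / F * F := by
  have h := c.card_leftover h2 h12 i
  rcases F.eq_zero_or_pos with rfl | hF
  · have : Nat.card (c.Leftover i) = 0 := by omega
    simp [this]
  have hF' : (F : ℝ) ≠ 0 := by positivity
  rw [div_mul_cancel₀ _ hF']
  have hr : (Nat.card (c.Leftover i) : ℝ) +
      ∑ j, (numSub K (point t j) : ℝ) * subSize K t F j = F := by exact_mod_cast h
  have h3 : ∀ j, weight t j * F - numSub K (point t j) ≤
      (numSub K (point t j) : ℝ) * subSize K t F j := by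
    intro j
    by_cases hj : weight t j = 0
    · have e1 : (0 : ℝ) ≤ numSub K (point t j) := Nat.cast_nonneg _
      have e2 : (0 : ℝ) ≤ (numSub K (point t j) : ℝ) * subSize K t F j := by positivity
      rw [hj]
      linarith
    · obtain ⟨a, b⟩ := point_le h2 h12 hK j hj
      have hS : (0 : ℝ) < numSub K (point t j) := by exact_mod_cast numSub_pos a b
      have e1 := (Nat.lt_floor_add_one (weight t j * F / numSub K (point t j))).le
      rw [div_le_iff₀ hS] at e1
      change _ ≤ ((subSize K t F j : ℝ) + 1) * _ at e1
      linarith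
  have h4 := Finset.sum_le_sum fun j (_ : j ∈ Finset.univ) => h3 j
  rw [Finset.sum_sub_distrib, ← Finset.sum_mul, sum_weight, one_mul] at h4
  linarith

/-- User `k` caches the fraction `Q_j i / K` of part `j` of file `i`. -/
lemma card_placement_le (hK : 1 ≤ K) (c : JointChoices 𝔽 K t F) (k : Fin K) (i : Fin 2) :
    ((c.placement k i).card : ℝ) ≤
      ∑ j, (numSub K (point t j) : ℝ) * subSize K t F j * (point t j i / K) := by
  classical
  have h1 : c.placement k i =
      ((Finset.univ : Finset (Fin 3)).sigma fun j =>
        (Finset.univ.filter fun τ : Label K (point t j) => k ∈ τ.1 i) ×ˢ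
          (Finset.univ : Finset (Fin (subSize K t F j)))).image (c.cellPos i) := by
    ext x
    simp only [placement, Finset.mem_filter, Finset.mem_univ, true_and, Finset.mem_image,
      Finset.mem_sigma, Finset.mem_product, and_true, cellPos]
    constructor
    · rintro ⟨j, τ, s, hk, h⟩
      exact ⟨⟨j, τ, s⟩, hk, h⟩
    · rintro ⟨⟨j, τ, s⟩, hk, h⟩
      exact ⟨j, τ, s, hk, h⟩
  have h2 := Finset.card_image_le (s := (Finset.univ : Finset (Fin 3)).sigma fun j =>
        (Finset.univ.filter fun τ : Label K (point t j) => k ∈ τ.1 i) ×ˢ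
          (Finset.univ : Finset (Fin (subSize K t F j)))) (f := c.cellPos i)
  rw [← h1, Finset.card_sigma] at h2
  refine (Nat.cast_le.2 h2).trans (le_of_eq ?_)
  rw [Nat.cast_sum]
  refine Finset.sum_congr rfl fun j _ => ?_
  rw [Finset.card_product, Finset.card_univ, Fintype.card_fin]
  have hK0 : (K : ℝ) ≠ 0 := by positivity
  have h3 : ((Finset.univ.filter fun τ : Label K (point t j) => k ∈ τ.1 i).card : ℝ) =
      numSub K (point t j) * (point t j i / K) := by
    have e1 := Finset.card_filter_add_card_filter_not (s := Finset.univ)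
      fun τ : Label K (point t j) => k ∈ τ.1 i
    have e2 : (Finset.univ.filter fun τ : Label K (point t j) => ¬ k ∈ τ.1 i).card =
        share K (point t j) 1 i := by
      rw [← Finset.card_singleton k, ← numMissing_eq_share, numMissing]
      simp only [Finset.disjoint_singleton_left]
    have e3 := mul_share_one hK (point t j) i
    rw [e2, Finset.card_univ, ← numSub_eq_card] at e1
    have e1' : ((Finset.univ.filter fun τ : Label K (point t j) => k ∈ τ.1 i).card : ℝ) +
        share K (point t j) 1 i = numSub K (point t j) := by exact_mod_cast e1
    have e3' : (K : ℝ) * share K (point t j) 1 i =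
        numSub K (point t j) * (K - point t j i) := by
      rcases numSub_eq_zero_or (K := K) (point t j) i with h0 | hr
      · rw [h0] at e3 ⊢
        simpa using e3
      · rw [← Nat.cast_sub hr]
        exact_mod_cast e3
    field_simp
    linear_combination (K : ℝ) * e1' - e3'
  push_cast
  rw [h3]
  ring

/-- The joint scheme respects the cache size. -/
lemma memory_le {M : ℝ} [Fintype 𝔽] (hK : 1 ≤ K) (ht : t ∈ allocations K M)
    (c : JointChoices 𝔽 K t F) (k : Fin K) :
    entropy (Fintype.card 𝔽) (cache (𝔽 := 𝔽) c.placement k) ≤ M * F := by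
  obtain ⟨h2, h12, -, hsum⟩ := ht
  have hK0 : (K : ℝ) ≠ 0 := by positivity
  rw [entropy_cache]
  have h1 : ∀ i, ((c.placement k i).card : ℝ) ≤ ![t.1, t.2] i * (F / K) := by
    intro i
    refine (c.card_placement_le hK k i).trans ?_
    rw [← sum_weight_mul_point, Finset.sum_mul]
    refine Finset.sum_le_sum fun j _ => ?_
    have := mul_le_mul_of_nonneg_right (numSub_mul_subSize_le (K := K) h2 h12 F j)
      (show (0 : ℝ) ≤ point t j i / K by positivity)
    refine this.trans (le_of_eq ?_)
    ring
  refine (Finset.sum_le_sum fun i _ => h1 i).trans (le_of_eq ?_)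
  rw [← Finset.sum_mul, Fin.sum_univ_two]
  simp only [Matrix.cons_val_zero, Matrix.cons_val_one]
  rw [hsum]
  field_simp

lemma decodable [Fintype 𝔽] (hK : 1 ≤ K) (c : JointChoices 𝔽 K t F) (d : Fin K → Fin 2) :
    Decodable c.placement d (c.message d) := by
  rw [decodable_iff]
  intro k W W' hX hc
  have h1 := congrArg Prod.fst hX
  have h2 := congrArg Prod.snd hX
  funext x
  by_cases hx : ∃ j τ s, c.pos (d k) j τ s = x
  · obtain ⟨j, τ, s, rfl⟩ := hx
    have := deliver_decode hK (c.codes j d) k (congrFun h1 j) (by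
      intro i τ hτ
      funext s
      exact hc i _ (Finset.mem_filter.2 ⟨Finset.mem_univ _, j, τ, s, hτ, rfl⟩))
    exact congrFun (congrFun this τ) s
  · push Not at hx
    exact congrFun (congrFun h2 ⟨d k, k, rfl⟩) ⟨x, hx⟩

/-- The rate of the delivery for the requests `d`, up to left-over symbols. -/
noncomputable def mainRate (K : ℕ) (t : ℝ × ℝ) (d : Fin K → Fin 2) : ℝ :=
  ∑ j, weight t j * ((numRows K (point t j) d : ℝ) / numSub K (point t j))

/-- Also true for `F = 0`, where the entropy vanishes. -/
lemma entropy_message_le [Fintype 𝔽] (h2 : 0 ≤ t.2) (h12 : t.2 ≤ t.1) (hK : t.1 ≤ K)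
    (c : JointChoices 𝔽 K t F) (d : Fin K → Fin 2) :
    entropy (Fintype.card 𝔽) (c.message d) ≤
      (mainRate K t d + 2 * (∑ j, (numSub K (point t j) : ℝ)) / F) * F := by
  classical
  choose f hf using fun j => deliver_eq (c.codes j d) (subSize K t F j)
  have h := entropy_le_of_factor (X := c.message d)
    (ι := (Σ j : Fin 3, Fin (numRows K (point t j) d) × Fin (subSize K t F j)) ⊕
      (Σ i : Fin 2, c.Leftover i))
    (fun W => Sum.elim (fun x => f x.1 (fun i τ s => W i (c.pos i x.1 τ s)) x.2.1 x.2.2)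
      fun x => W x.1 x.2.1) (by
        intro W W' h
        refine Prod.ext (funext fun j => ?_) (funext fun i => funext fun x => ?_)
        · change deliver (c.codes j d) _ = deliver (c.codes j d) _
          rw [hf, hf]
          congr 1
          funext a s
          exact congrFun h (Sum.inl ⟨j, a, s⟩)
        · exact congrFun h (Sum.inr ⟨i.1, x⟩))
  refine h.trans ?_
  rw [Nat.card_sum, Nat.card_sigma, Nat.card_sigma, Nat.cast_add, add_mul]
  refine add_le_add ?_ ?_
  · rw [mainRate, Finset.sum_mul, Nat.cast_sum]
    refine Finset.sum_le_sum fun j _ => ?_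
    rw [Nat.card_prod, Nat.card_fin, Nat.card_fin, Nat.cast_mul]
    have e1 : (subSize K t F j : ℝ) ≤ weight t j * F / numSub K (point t j) := by
      have := weight_nonneg h2 h12 j
      exact Nat.floor_le (by positivity)
    have e2 := mul_le_mul_of_nonneg_left e1 (Nat.cast_nonneg (α := ℝ) (numRows K (point t j) d))
    refine e2.trans (le_of_eq ?_)
    ring
  · have e1 := c.card_leftover_le h2 h12 hK
    rw [Fin.sum_univ_two, Nat.cast_add]
    refine (add_le_add (e1 0) (e1 1)).trans (le_of_eq ?_)
    ring

/-- The expectation of `mainRate` is at most the rate expression. -/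
lemma expected_mainRate_le (hK : 1 ≤ K) {p : Fin 2 → ℝ} (hp0 : 0 ≤ p 0) (hp1 : 0 ≤ p 1)
    (hp : p 0 + p 1 = 1) (h2 : 0 ≤ t.2) (h12 : t.2 ≤ t.1) (htK : t.1 ≤ K) :
    ∑ d : Fin K → Fin 2, (∏ k, p (d k)) * mainRate K t d ≤ rateBar K p t := by
  classical
  have h : ∀ d : Fin K → Fin 2, mainRate K t d =
      if ∀ k, d k = 0 then
        ∑ j, weight t j * ((singleRows K (point t j) 0 : ℝ) / numSub K (point t j))
      else if ∀ k, d k = 1 then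
        ∑ j, weight t j * ((singleRows K (point t j) 1 : ℝ) / numSub K (point t j))
      else ∑ j, weight t j * ((jointRows K (point t j) : ℝ) / numSub K (point t j)) := by
    intro d
    unfold mainRate numRows
    split_ifs <;> rfl
  have hs : ∀ i, ∑ j, weight t j * ((singleRows K (point t j) i : ℝ) / numSub K (point t j)) =
      (K - ![t.1, t.2] i) / K := by
    intro i
    have : ∀ j, weight t j * ((singleRows K (point t j) i : ℝ) / numSub K (point t j)) =
        (weight t j * K - weight t j * point t j i) / K := by
      intro j
      by_cases hj : weight t j = 0
      · simp [hj]
      · obtain ⟨a, b⟩ := point_le h2 h12 htK j hj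
        rw [singleRows_div hK i (numSub_pos a b).ne']
        ring
    simp only [this]
    rw [← Finset.sum_div, Finset.sum_sub_distrib, ← Finset.sum_mul, sum_weight,
      sum_weight_mul_point, one_mul]
  simp only [h]
  rw [sum_prob_mul hK hp, hs, hs, rateBar]
  refine add_le_add le_rfl ?_
  -- a single user never requests both files
  rcases hK.eq_or_lt with rfl | hK2
  · have : 1 - p 0 ^ 1 - p 1 ^ 1 = 0 := by linarith
    rw [this, zero_mul, zero_mul]
  · exact mul_le_mul_of_nonneg_left (sum_weight_mul_jointRows hK2 h2 h12 htK)
      (mixed_prob_nonneg hK hp0 hp1 hp)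

end JointChoices

/-- The joint scheme at any allocation achieves the value of the rate expression there. -/
theorem jointScheme_achieves {𝔽 : Type u} [Field 𝔽] [Fintype 𝔽] {K : ℕ} (hK : 1 ≤ K)
    {p : Fin 2 → ℝ} (hp0 : 0 ≤ p 0) (hp1 : 0 ≤ p 1) (hp : p 0 + p 1 = 1) {M : ℝ} {t : ℝ × ℝ}
    (ht : t ∈ allocations K M) (c : (F : ℕ) → JointChoices 𝔽 K t F) :
    AchievesExpectedRate M p (fun F => (c F).placement) (fun F d => (c F).message d)
      (rateBar K p t) := by
  have ht' := ht
  obtain ⟨h2, h12, htK, -⟩ := ht'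
  refine ⟨fun F k => (c F).memory_le hK ht k, fun d F => JointChoices.mainRate K t d +
    2 * (∑ j, (numSub K (point t j) : ℝ)) / F, fun d F =>
    ⟨(c F).decodable hK d, (c F).entropy_message_le h2 h12 htK d⟩, ?_⟩
  have hlim : Filter.Tendsto (fun F : ℕ => ∑ d : Fin K → Fin 2, (∏ k, p (d k)) *
      (JointChoices.mainRate K t d + 2 * (∑ j, (numSub K (point t j) : ℝ)) / F)) Filter.atTop
      (nhds (∑ d : Fin K → Fin 2, (∏ k, p (d k)) * JointChoices.mainRate K t d)) := by
    refine tendsto_finsetSum _ fun d _ => Filter.Tendsto.const_mul _ ?_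
    simpa using tendsto_const_nhds.add (tendsto_const_div_atTop_nhds_zero_nat
      (2 * ∑ j, (numSub K (point t j) : ℝ)))
  refine ((continuous_coe_real_ereal.tendsto _).comp hlim).limsup_eq.trans_le ?_
  exact_mod_cast JointChoices.expected_mainRate_le hK hp0 hp1 hp h2 h12 htK

/-! ### The converse bound -/

open Classical in
/-- Separating the two request vectors for which only one file is requested. -/
lemma sum_prob_split {K : ℕ} (hK : 1 ≤ K) (p : Fin 2 → ℝ) (R : (Fin K → Fin 2) → ℝ) :
    ∑ d : Fin K → Fin 2, (∏ k, p (d k)) * R d =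
      p 0 ^ K * R (fun _ => 0) + p 1 ^ K * R (fun _ => 1) +
        ∑ d : Fin K → Fin 2, if Mixed d then (∏ k, p (d k)) * R d else 0 := by
  have h : ∀ d : Fin K → Fin 2, (∏ k, p (d k)) * R d =
      (if d = fun _ => 0 then (∏ k, p (d k)) * R d else 0) +
      (if d = fun _ => 1 then (∏ k, p (d k)) * R d else 0) +
      (if Mixed d then (∏ k, p (d k)) * R d else 0) := by
    intro d
    by_cases h0 : d = fun _ => 0
    · have h1 : d ≠ fun _ => 1 := fun h1 => by
        have := congrFun (h0.symm.trans h1) ⟨0, hK⟩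
        simp at this
      have h2 : ¬ Mixed d := fun h2 => by
        obtain ⟨k, hk⟩ := h2 1
        rw [h0] at hk
        simp at hk
      rw [if_pos h0, if_neg h1, if_neg h2, add_zero, add_zero]
    · by_cases h1 : d = fun _ => 1
      · have h2 : ¬ Mixed d := fun h2 => by
          obtain ⟨k, hk⟩ := h2 0
          rw [h1] at hk
          simp at hk
        rw [if_neg h0, if_pos h1, if_neg h2, zero_add, add_zero]
      · have h2 : Mixed d := mixed_of_not_const (fun h => h0 (funext h)) (fun h => h1 (funext h))
        rw [if_neg h0, if_neg h1, if_pos h2, zero_add, zero_add]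
  rw [Finset.sum_congr rfl fun d _ => h d]
  simp only [Finset.sum_add_distrib, Finset.sum_ite_eq', Finset.mem_univ, if_true,
    Finset.prod_const, Finset.card_univ, Fintype.card_fin]

/-- The permutations act doubly transitively on the users. -/
lemma exists_perm_pair {K : ℕ} {u v u' v' : Fin K} (h : u ≠ v) (h' : u' ≠ v') :
    ∃ σ : Equiv.Perm (Fin K), σ u = u' ∧ σ v = v' := by
  refine ⟨(Equiv.swap u u').trans (Equiv.swap (Equiv.swap u u' v) v'), ?_, ?_⟩
  · have h1 : u' ≠ Equiv.swap u u' v := fun h1 => by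
      have := (Equiv.swap u u').injective ((Equiv.swap_apply_left u u').trans h1)
      exact h this
    simp only [Equiv.trans_apply, Equiv.swap_apply_left]
    exact Equiv.swap_apply_of_ne_of_ne h1 h'
  · simp

open Classical in
/-- Average over the pairs (user requesting file `0`, user requesting file `1`) of every request
vector, and over the request vectors: by exchangeability of the requests, all ordered pairs of
distinct users get the same weight. -/
lemma mixed_average {K : ℕ} (hK : 2 ≤ K) {p : Fin 2 → ℝ} (hp0 : 0 ≤ p 0) (hp1 : 0 ≤ p 1)
    (R : (Fin K → Fin 2) → ℝ) (b : Fin K → Fin K → ℝ) (B : ℝ)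
    (hb : ∀ d u v, d u = 0 → d v = 1 → b u v ≤ R d)
    (hB : (K : ℝ) * (K - 1) * B ≤ ∑ u, ∑ v, b u v - ∑ u, b u u) :
    (∑ d : Fin K → Fin 2, if Mixed d then ∏ k, p (d k) else 0) * B ≤
      ∑ d : Fin K → Fin 2, if Mixed d then (∏ k, p (d k)) * R d else 0 := by
  -- `κ d` is the share of the probability of `d` that each of its pairs gets, and `w u v` is the
  -- total share of the pair `(u, v)`
  let κ : (Fin K → Fin 2) → ℝ := fun d =>
    (∏ k, p (d k)) / ((requesters d 0).card * (requesters d 1).card)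
  let w : Fin K → Fin K → ℝ := fun u v => ∑ d : Fin K → Fin 2, if d u = 0 ∧ d v = 1 then κ d else 0
  have hp : ∀ i, 0 ≤ p i := by simp [Fin.forall_fin_two, hp0, hp1]
  have hκ : ∀ d, 0 ≤ κ d := fun d =>
    div_nonneg (Finset.prod_nonneg fun k _ => hp _) (by positivity)
  have hsum : ∀ d, ∑ u, ∑ v, (if d u = 0 ∧ d v = 1 then κ d else 0) =
      if Mixed d then ∏ k, p (d k) else 0 := by
    intro d
    have h1 : ∀ u v, (if d u = 0 ∧ d v = 1 then κ d else 0) =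
        (if d u = 0 then 1 else 0) * ((if d v = 1 then 1 else 0) * κ d) := by
      intro u v
      by_cases hu : d u = 0 <;> by_cases hv : d v = 1 <;> simp [hu, hv]
    simp only [h1, ← Finset.mul_sum, ← Finset.sum_mul, Finset.sum_boole]
    change ((requesters d 0).card : ℝ) * ((requesters d 1).card * κ d) = _
    have h2 : ∀ i, (requesters d i).card ≠ 0 ↔ ∃ k, d k = i := fun i => by
      rw [← Nat.pos_iff_ne_zero, Finset.card_pos]
      simp [Finset.Nonempty, requesters]
    by_cases hd : Mixed d
    · rw [if_pos hd]
      have e0 : ((requesters d 0).card : ℝ) ≠ 0 := by exact_mod_cast (h2 0).2 (hd 0)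
      have e1 : ((requesters d 1).card : ℝ) ≠ 0 := by exact_mod_cast (h2 1).2 (hd 1)
      simp only [κ]
      field_simp
    · rw [if_neg hd]
      have : ∃ i, (requesters d i).card = 0 := by
        by_contra hne
        push Not at hne
        exact hd fun i => (h2 i).1 (hne i)
      obtain ⟨i, hi⟩ := this
      fin_cases i
      · simp only [Fin.zero_eta] at hi
        simp [hi]
      · simp only [Fin.mk_one] at hi
        simp [hi]
  have hinv : ∀ (σ : Equiv.Perm (Fin K)) u v, w (σ u) (σ v) = w u v := by
    intro σ u v
    refine Fintype.sum_equiv (Equiv.arrowCongr σ.symm (Equiv.refl _)) _ _ fun d => ?_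
    have h1 : ∀ i, (requesters (Equiv.arrowCongr σ.symm (Equiv.refl _) d) i).card =
        (requesters d i).card := fun i =>
      Finset.card_equiv σ fun k => by simp [requesters]
    have h2 : ∏ k, p (Equiv.arrowCongr σ.symm (Equiv.refl _) d k) = ∏ k, p (d k) :=
      Fintype.prod_equiv σ _ _ fun k => by simp
    simp only [κ, h1, h2]
    simp
  have hdiag : ∀ u, w u u = 0 := fun u =>
    Finset.sum_eq_zero fun d _ => if_neg fun h => by simp [h.1] at h
  obtain ⟨ω, hω0, hω⟩ : ∃ ω : ℝ, 0 ≤ ω ∧ ∀ u v, u ≠ v → w u v = ω := by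
    have h01 : (⟨0, by omega⟩ : Fin K) ≠ ⟨1, by omega⟩ := by simp
    refine ⟨w ⟨0, by omega⟩ ⟨1, by omega⟩, Finset.sum_nonneg fun d _ => ?_, fun u v huv => ?_⟩
    · split_ifs
      · exact hκ d
      · exact le_rfl
    · obtain ⟨σ, rfl, rfl⟩ := exists_perm_pair h01 huv
      exact hinv σ _ _
  have hwb : ∀ g : Fin K → Fin K → ℝ, ∑ u, ∑ v, w u v * g u v =
      ω * (∑ u, ∑ v, g u v - ∑ u, g u u) := by
    intro g
    have h1 : ∀ u v, w u v * g u v = ω * g u v - if u = v then ω * g u v else 0 := by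
      intro u v
      split_ifs with h
      · rw [h, hdiag]
        ring
      · rw [hω u v h, sub_zero]
    simp only [h1, Finset.sum_sub_distrib, Finset.sum_ite_eq, Finset.mem_univ, if_true,
      ← Finset.mul_sum]
    ring
  have hmix : (∑ d : Fin K → Fin 2, if Mixed d then ∏ k, p (d k) else 0) =
      ω * (K * (K - 1)) := by
    have h1 := hwb fun _ _ => 1
    simp only [mul_one, Finset.sum_const, Finset.card_univ, Fintype.card_fin, nsmul_eq_mul] at h1
    rw [← Finset.sum_congr rfl fun d _ => hsum d, Finset.sum_comm]
    simp only [Finset.sum_comm (s := (Finset.univ : Finset (Fin K → Fin 2)))]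
    refine h1.trans ?_
    ring
  calc (∑ d : Fin K → Fin 2, if Mixed d then ∏ k, p (d k) else 0) * B
      = ω * (K * (K - 1) * B) := by rw [hmix]; ring
    _ ≤ ω * (∑ u, ∑ v, b u v - ∑ u, b u u) := mul_le_mul_of_nonneg_left hB hω0
    _ = ∑ u, ∑ v, w u v * b u v := (hwb b).symm
    _ = ∑ d : Fin K → Fin 2, ∑ u, ∑ v, (if d u = 0 ∧ d v = 1 then κ d else 0) * b u v := by
        simp only [w, Finset.sum_mul]
        rw [Finset.sum_comm (s := (Finset.univ : Finset (Fin K → Fin 2)))]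
        simp only [Finset.sum_comm (s := (Finset.univ : Finset (Fin K → Fin 2)))]
    _ ≤ ∑ d : Fin K → Fin 2, ∑ u, ∑ v, (if d u = 0 ∧ d v = 1 then κ d else 0) * R d := by
        refine Finset.sum_le_sum fun d _ => Finset.sum_le_sum fun u _ =>
          Finset.sum_le_sum fun v _ => ?_
        split_ifs with h
        · exact mul_le_mul_of_nonneg_left (hb d u v h.1 h.2) (hκ d)
        · simp
    _ = ∑ d : Fin K → Fin 2, if Mixed d then (∏ k, p (d k)) * R d else 0 := by
        refine Finset.sum_congr rfl fun d _ => ?_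
        simp only [← Finset.sum_mul]
        rw [hsum]
        split_ifs <;> simp

section Bounds

variable {𝔽 : Type u} [Field 𝔽] [Fintype 𝔽] {K F : ℕ} {A : UncodedPlacement K 2 F}
  {d : Fin K → Fin 2} {B : Type u} {X : Files 𝔽 2 F → B}

/-- Only file `i` is requested: the message carries the symbols of file `i` that user `k` misses. -/
lemma entropy_ge_single (hX : Decodable A d X) {i : Fin 2} (hd : ∀ k, d k = i) (k : Fin K) :
    (F : ℝ) - (A k i).card ≤ entropy (Fintype.card 𝔽) X := by
  classical
  rw [decodable_iff] at hX
  have h := le_entropy_of_determined X (fun l => if l = i then A k i else Finset.univ) (by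
    intro W W' hXW hT
    have hother : ∀ l, l ≠ i → W l = W' l := fun l hl =>
      funext fun x => hT l x (by simp [hl])
    have hi : W i = W' i := by
      have := hX k W W' hXW fun l x hx => by
        by_cases hl : l = i
        · subst hl
          exact hT l x (by simpa using hx)
        · rw [hother l hl]
      rwa [hd k] at this
    funext l
    by_cases hl : l = i
    · rw [hl, hi]
    · exact hother l hl)
  refine le_trans (le_of_eq ?_) h
  fin_cases i <;> simp [Fin.sum_univ_two] <;> ring

/-- Both files are requested, file `i` by user `u` and file `j` by user `v`. User `u` decodes file
`i`; then `v` decodes file `j` with the help of the cache of `u`. -/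
lemma entropy_ge_pair (hX : Decodable A d X) {i j : Fin 2} (hij : i ≠ j) {u v : Fin K}
    (hu : d u = i) (hv : d v = j) :
    ((F : ℝ) - (A u i).card) + (F - (A u j ∪ A v j).card) ≤ entropy (Fintype.card 𝔽) X := by
  classical
  rw [decodable_iff] at hX
  have hl : ∀ l : Fin 2, l = i ∨ l = j := by omega
  have h := le_entropy_of_determined X (fun l => if l = i then A u l else A u l ∪ A v l) (by
    intro W W' hXW hT
    have hi : W i = W' i := by
      have := hX u W W' hXW fun l x hx => hT l x (by split_ifs <;> simp [hx])
      rwa [hu] at this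
    have hj : W j = W' j := by
      have := hX v W W' hXW fun l x hx => by
        rcases hl l with rfl | rfl
        · rw [hi]
        · exact hT l x (by simp [hij.symm, hx])
      rwa [hv] at this
    funext l
    rcases hl l with rfl | rfl
    · exact hi
    · exact hj)
  refine le_trans (le_of_eq ?_) h
  have hsum : ∀ f : Fin 2 → ℝ, ∑ l, f l = f i + f j := by
    intro f
    have huniv : (Finset.univ : Finset (Fin 2)) = {i, j} := by
      ext l
      simpa using hl l
    rw [huniv, Finset.sum_pair hij]
  rw [hsum]
  simp [hij.symm]

end Bounds

section Averages

variable {K F : ℕ}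

/-- Sum over the ordered pairs of distinct users of the number of symbols missed by both; the bound
is Jensen's inequality for the convex sequence `s ↦ (K - s) (K - s - 1)`, in the form that the
sequence lies above the chord over `[⌊x⌋, ⌊x⌋ + 1]`. -/
lemma le_sum_pairs (hK : 2 ≤ K) (S : Fin K → Finset (Fin F)) {x : ℝ} (hx0 : 0 ≤ x) (hxK : x ≤ K)
    (hS : ∑ k, ((S k).card : ℝ) ≤ F * x) :
    (K : ℝ) * (K - 1) * (F * interp K 2 x) ≤
      ∑ u, ∑ v, ((F : ℝ) - (S u ∪ S v).card) - ∑ u, ((F : ℝ) - (S u ∪ S u).card) := by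
  classical
  have hKr : (2 : ℝ) ≤ K := by exact_mod_cast hK
  -- `e y u` indicates that user `u` misses symbol `y`; `s y` is the number of users storing `y`
  let e : Fin F → Fin K → ℝ := fun y u => if y ∈ S u then 0 else 1
  have hpair : ∀ u v, (F : ℝ) - (S u ∪ S v).card = ∑ y, e y u * e y v := by
    intro u v
    have h1 : ∀ y, e y u * e y v = 1 - if y ∈ S u ∪ S v then 1 else 0 := by
      intro y
      by_cases hu : y ∈ S u <;> by_cases hv : y ∈ S v <;> simp [e, hu, hv]
    simp only [h1, Finset.sum_sub_distrib, Finset.sum_boole, Finset.filter_univ_mem]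
    simp
  have hm : ∀ y, ∃ s : ℕ, ∑ u, e y u = K - s ∧ ∑ u, (if y ∈ S u then (1 : ℝ) else 0) = s := by
    intro y
    refine ⟨(Finset.univ.filter fun u => y ∈ S u).card, ?_, by simp⟩
    have h1 : ∀ u, e y u = 1 - if y ∈ S u then 1 else 0 := by
      intro u
      by_cases hu : y ∈ S u <;> simp [e, hu]
    simp only [h1]
    simp
  choose s hs1 hs2 using hm
  have htot : ∑ y, (s y : ℝ) = ∑ k, ((S k).card : ℝ) := by
    simp only [← hs2]
    rw [Finset.sum_comm]
    simp
  have hlhs : ∑ u, ∑ v, ((F : ℝ) - (S u ∪ S v).card) - ∑ u, ((F : ℝ) - (S u ∪ S u).card) =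
      ∑ y, ((K : ℝ) - s y) * (K - s y - 1) := by
    simp only [hpair]
    have h1 : ∑ u, ∑ v, ∑ y, e y u * e y v = ∑ y, (∑ u, e y u) * (∑ v, e y v) := by
      simp only [Finset.sum_mul_sum]
      rw [Finset.sum_comm (s := (Finset.univ : Finset (Fin F)))]
      simp only [Finset.sum_comm (s := (Finset.univ : Finset (Fin F)))]
    have h2 : ∑ u, ∑ y, e y u * e y u = ∑ y, ∑ u, e y u := by
      rw [Finset.sum_comm]
      refine Finset.sum_congr rfl fun y _ => Finset.sum_congr rfl fun u _ => ?_
      by_cases hu : y ∈ S u <;> simp [e, hu]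
    rw [h1, h2, ← Finset.sum_sub_distrib]
    refine Finset.sum_congr rfl fun y _ => ?_
    rw [hs1]
    ring
  rw [hlhs]
  -- the difference of the two sides is a product of consecutive integers
  have hchord : ∀ y, ((K : ℝ) - ⌊x⌋ - 1) * (K + ⌊x⌋ - 2 * s y) ≤
      ((K : ℝ) - s y) * (K - s y - 1) := by
    intro y
    have h1 : 0 ≤ ((s y : ℤ) - ⌊x⌋) * ((s y : ℤ) - ⌊x⌋ - 1) := by
      rcases le_or_gt ((s y : ℤ) - ⌊x⌋) 0 with h | h
      · exact mul_nonneg_of_nonpos_of_nonpos h (by omega)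
      · exact mul_nonneg h.le (by omega)
    have h2 : (0 : ℝ) ≤ ((s y : ℝ) - ⌊x⌋) * ((s y : ℝ) - ⌊x⌋ - 1) := by exact_mod_cast h1
    nlinarith
  have hden : (K : ℝ) * (K - 1) ≠ 0 := by
    have : (0 : ℝ) < K * (K - 1) := by nlinarith
    exact this.ne'
  rw [interp_two_eq_line (by omega) hx0 hxK]
  have hL : (K : ℝ) * (K - 1) * (F * (((K : ℝ) - ⌊x⌋ - 1) * (K + ⌊x⌋ - 2 * x) / (K * (K - 1)))) =
      ((K : ℝ) - ⌊x⌋ - 1) * (F * (K + ⌊x⌋) - 2 * (F * x)) := by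
    rw [← mul_assoc, mul_div_assoc', div_eq_iff hden]
    ring
  rw [hL]
  have hfl : ⌊x⌋ ≤ K := by
    have := (Int.floor_le x).trans hxK
    exact_mod_cast this
  have hsum : ∑ y, ((K : ℝ) - ⌊x⌋ - 1) * (K + ⌊x⌋ - 2 * s y) =
      ((K : ℝ) - ⌊x⌋ - 1) * (F * (K + ⌊x⌋) - 2 * ∑ k, ((S k).card : ℝ)) := by
    rw [← Finset.mul_sum, Finset.sum_sub_distrib, ← Finset.mul_sum, htot]
    simp only [Finset.sum_const, Finset.card_univ, Fintype.card_fin, nsmul_eq_mul]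
  rcases hfl.lt_or_eq with h | h
  · have h1 : (0 : ℝ) ≤ (K : ℝ) - ⌊x⌋ - 1 := by
      have : ((⌊x⌋ + 1 : ℤ) : ℝ) ≤ ((K : ℤ) : ℝ) := by exact_mod_cast h
      push_cast at this
      linarith
    calc _ ≤ ((K : ℝ) - ⌊x⌋ - 1) * (F * (K + ⌊x⌋) - 2 * ∑ k, ((S k).card : ℝ)) :=
          mul_le_mul_of_nonneg_left (by linarith) h1
      _ = ∑ y, ((K : ℝ) - ⌊x⌋ - 1) * (K + ⌊x⌋ - 2 * s y) := hsum.symm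
      _ ≤ _ := Finset.sum_le_sum fun y _ => hchord y
  -- for `x = K` the chord has positive slope, but the interpolation vanishes
  · have h1 : (⌊x⌋ : ℝ) = K := by exact_mod_cast h
    have h2 : x = K := le_antisymm hxK (by rw [← h1]; exact Int.floor_le x)
    have h3 : ((K : ℝ) - ⌊x⌋ - 1) * (F * (K + ⌊x⌋) - 2 * (F * x)) = 0 := by
      rw [h1, h2]
      ring
    rw [h3]
    refine Finset.sum_nonneg fun y _ => ?_
    have h4 : 0 ≤ ((K : ℤ) - s y) * ((K : ℤ) - s y - 1) := by
      rcases le_or_gt ((K : ℤ) - s y) 0 with h | h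
      · exact mul_nonneg_of_nonpos_of_nonpos h (by omega)
      · exact mul_nonneg h.le (by omega)
    exact_mod_cast h4

/-- Lower bound on the cut-set expressions of all ordered pairs of distinct users. -/
lemma le_sum_cuts (hK : 2 ≤ K) (hF : 1 ≤ F) (S T : Fin K → Finset (Fin F)) {x y : ℝ}
    (hx0 : 0 ≤ x) (hxK : x ≤ K) (hy0 : 0 ≤ y) (hyK : y ≤ K)
    (hS : ∑ k, ((S k).card : ℝ) ≤ F * x) (hT : ∑ k, ((T k).card : ℝ) ≤ F * y) :
    (K : ℝ) * (K - 1) * (interp K 1 x + interp K 2 y) ≤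
      ∑ u, ∑ v, (((F : ℝ) - (S u).card) + (F - (T u ∪ T v).card)) / F -
        ∑ u, (((F : ℝ) - (S u).card) + (F - (T u ∪ T u).card)) / F := by
  classical
  have hF' : (0 : ℝ) < F := by exact_mod_cast hF
  have hKr : (2 : ℝ) ≤ K := by exact_mod_cast hK
  have h1 := le_sum_pairs hK T hy0 hyK hT
  simp only [← Finset.sum_div, Finset.sum_add_distrib]
  rw [← sub_div, le_div_iff₀ hF', interp_one (by omega) hx0 hxK]
  have h2 : ∑ u : Fin K, ∑ _v : Fin K, ((F : ℝ) - (S u).card) =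
      K * ∑ u : Fin K, ((F : ℝ) - (S u).card) := by
    simp only [Finset.sum_const, Finset.card_univ, Fintype.card_fin, nsmul_eq_mul,
      ← Finset.mul_sum]
  have h3 : ∑ u : Fin K, ((F : ℝ) - (S u).card) = K * F - ∑ k, ((S k).card : ℝ) := by
    rw [Finset.sum_sub_distrib]
    simp
  have h4 : (K : ℝ) * (K - 1) * ((K - x) / K) * F = (K - 1) * (K * F - F * x) := by
    field_simp
  have h5 : ((K : ℝ) - 1) * (K * F - F * x) ≤ (K - 1) * (K * F - ∑ k, ((S k).card : ℝ)) :=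
    mul_le_mul_of_nonneg_left (by linarith) (by linarith)
  rw [h2, h3]
  linarith

end Averages

/-- An allocation that dominates given average cache sizes. -/
lemma exists_allocation_ge {K : ℕ} {M a b : ℝ} (hM : M ≤ 2) (hb : 0 ≤ b) (hba : b ≤ a)
    (ha : a ≤ K) (hab : a + b ≤ K * M) :
    ∃ t ∈ allocations K M, a ≤ t.1 ∧ b ≤ t.2 := by
  have hKM : (K : ℝ) * M ≤ K * 2 := mul_le_mul_of_nonneg_left hM (Nat.cast_nonneg K)
  rcases le_total (K * M - b) K with h | h
  · exact ⟨(K * M - b, b), ⟨hb, by simp only; linarith, h, by simp⟩, by simp only; linarith, le_rfl⟩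
  · exact ⟨(K, K * M - K), ⟨by simp only; linarith, by simp only; linarith, le_rfl, by simp⟩, ha,
      by simp only; linarith⟩

/-- For every file size, the expected rate is at least the rate expression at some allocation. -/
lemma exists_rateBar_le {𝔽 : Type u} [Field 𝔽] [Fintype 𝔽] {K F : ℕ} (hK : 1 ≤ K) (hF : 1 ≤ F)
    {p : Fin 2 → ℝ} (hp1 : 0 ≤ p 1) (hp01 : p 1 ≤ p 0) (hp : p 0 + p 1 = 1) {M : ℝ} (hM : M ≤ 2)
    (A : UncodedPlacement K 2 F)
    (hA : ∀ k, entropy (Fintype.card 𝔽) (cache (𝔽 := 𝔽) A k) ≤ M * F)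
    {B : (Fin K → Fin 2) → Type u} (X : (d : Fin K → Fin 2) → Files 𝔽 2 F → B d)
    (R : (Fin K → Fin 2) → ℝ)
    (hX : ∀ d, Decodable A d (X d) ∧ entropy (Fintype.card 𝔽) (X d) ≤ R d * F) :
    ∃ t ∈ allocations K M, rateBar K p t ≤ ∑ d : Fin K → Fin 2, (∏ k, p (d k)) * R d := by
  classical
  have hF' : (0 : ℝ) < F := by exact_mod_cast hF
  have hK' : (0 : ℝ) < K := by exact_mod_cast hK
  have hp0 : 0 ≤ p 0 := hp1.trans hp01
  -- the average number of copies of a symbol of file `i`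
  let a : Fin 2 → ℝ := fun i => (∑ k, ((A k i).card : ℝ)) / F
  have ha : ∀ i, ∑ k, ((A k i).card : ℝ) = F * a i := fun i =>
    (mul_div_cancel₀ _ hF'.ne').symm
  have ha0 : ∀ i, 0 ≤ a i := fun i =>
    div_nonneg (Finset.sum_nonneg fun _ _ => Nat.cast_nonneg _) (Nat.cast_nonneg _)
  have haK : ∀ i, a i ≤ K := by
    intro i
    rw [div_le_iff₀ hF']
    have : ∀ k ∈ (Finset.univ : Finset (Fin K)), ((A k i).card : ℝ) ≤ F := fun k _ => by
      have := Finset.card_le_univ (A k i)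
      rw [Fintype.card_fin] at this
      exact_mod_cast this
    refine (Finset.sum_le_sum this).trans ?_
    simp
  have hasum : a 0 + a 1 ≤ K * M := by
    have h1 := Finset.sum_le_sum fun k (_ : k ∈ (Finset.univ : Finset (Fin K))) =>
      (entropy_cache (𝔽 := 𝔽) A k).symm.trans_le (hA k)
    simp only [Fin.sum_univ_two, Finset.sum_add_distrib, ha] at h1
    simp only [Finset.sum_const, Finset.card_univ, Fintype.card_fin, nsmul_eq_mul] at h1
    refine le_of_mul_le_mul_left ?_ hF'
    linarith
  have hsingle : ∀ i, ((K : ℝ) - a i) / K ≤ R fun _ => i := by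
    intro i
    have h1 := Finset.sum_le_sum fun k (_ : k ∈ (Finset.univ : Finset (Fin K))) =>
      (entropy_ge_single (hX fun _ => i).1 (fun _ => rfl) k).trans (hX fun _ => i).2
    rw [Finset.sum_sub_distrib, ha] at h1
    simp only [Finset.sum_const, Finset.card_univ, Fintype.card_fin, nsmul_eq_mul] at h1
    rw [div_le_iff₀ hK']
    refine le_of_mul_le_mul_left ?_ hF'
    linarith
  have hprob : (∑ d : Fin K → Fin 2, if Mixed d then ∏ k, p (d k) else 0) =
      1 - p 0 ^ K - p 1 ^ K := by
    have h1 := sum_prob_split hK p fun _ => 1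
    simp only [mul_one, sum_prob hp] at h1
    linarith
  set mixR := ∑ d : Fin K → Fin 2, if Mixed d then (∏ k, p (d k)) * R d else 0 with hmixR
  have hmixed : ∀ x : Fin 2 → ℝ, (∀ i, a i ≤ x i) → (∀ i, x i ≤ K) →
      (1 - p 0 ^ K - p 1 ^ K) * max (interp K 1 (x 0) + interp K 2 (x 1))
        (interp K 2 (x 0) + interp K 1 (x 1)) ≤ mixR := by
    intro x hax hxK
    rcases hK.eq_or_lt with rfl | hK2
    · have h0 : mixR = 0 := Finset.sum_eq_zero fun d _ => if_neg fun hd => by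
        obtain ⟨k0, h0⟩ := hd 0
        obtain ⟨k1, h1⟩ := hd 1
        rw [Subsingleton.elim k0 k1, h1] at h0
        simp at h0
      have : 1 - p 0 ^ 1 - p 1 ^ 1 = 0 := by linarith
      rw [h0, this, zero_mul]
    have hx0 : ∀ i, 0 ≤ x i := fun i => (ha0 i).trans (hax i)
    have hA' : ∀ i, ∑ k, ((A k i).card : ℝ) ≤ F * x i := fun i => by
      rw [ha]
      exact mul_le_mul_of_nonneg_left (hax i) hF'.le
    have c1 := le_sum_cuts hK2 hF (fun k => A k 0) (fun k => A k 1) (hx0 0) (hxK 0) (hx0 1)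
      (hxK 1) (hA' 0) (hA' 1)
    have c2 := le_sum_cuts hK2 hF (fun k => A k 1) (fun k => A k 0) (hx0 1) (hxK 1) (hx0 0)
      (hxK 0) (hA' 1) (hA' 0)
    rw [Finset.sum_comm, add_comm (interp K 1 _)] at c2
    rw [← hprob]
    rcases max_choice (interp K 1 (x 0) + interp K 2 (x 1))
      (interp K 2 (x 0) + interp K 1 (x 1)) with h | h <;> rw [h]
    · refine mixed_average hK2 hp0 hp1 R _ _ (fun d u v hu hv => ?_) c1
      rw [div_le_iff₀ hF']
      exact (entropy_ge_pair (hX d).1 (by simp) hu hv).trans (hX d).2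
    · refine mixed_average hK2 hp0 hp1 R _ _ (fun d u v hu hv => ?_) c2
      rw [div_le_iff₀ hF']
      exact (entropy_ge_pair (hX d).1 (by simp) hv hu).trans (hX d).2
  rw [sum_prob_split hK p R, ← hmixR]
  have hq0 : 0 ≤ p 0 ^ K := pow_nonneg hp0 K
  have hq1 : 0 ≤ p 1 ^ K := pow_nonneg hp1 K
  have hq01 : p 1 ^ K ≤ p 0 ^ K := pow_le_pow_left₀ hp1 hp01 K
  have hs0 := mul_le_mul_of_nonneg_left (hsingle 0) hq0
  have hs1 := mul_le_mul_of_nonneg_left (hsingle 1) hq1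
  have hmono : ∀ {y z : ℝ}, y ≤ z → ((K : ℝ) - z) / K ≤ (K - y) / K := fun h =>
    div_le_div_of_nonneg_right (by linarith) hK'.le
  rcases le_total (a 1) (a 0) with h | h
  · obtain ⟨t, ht, h0, h1⟩ := exists_allocation_ge hM (ha0 1) h (haK 0) hasum
    refine ⟨t, ht, ?_⟩
    have hm := hmixed ![t.1, t.2] (by simp [Fin.forall_fin_two, h0, h1])
      (by simpa [Fin.forall_fin_two] using ⟨ht.2.2.1, ht.2.1.trans ht.2.2.1⟩)
    have e0 := mul_le_mul_of_nonneg_left (hmono h0) hq0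
    have e1 := mul_le_mul_of_nonneg_left (hmono h1) hq1
    simp only [Matrix.cons_val_zero, Matrix.cons_val_one] at hm
    unfold rateBar
    linarith
  · -- caching more of the less popular file is not better than the swapped allocation
    obtain ⟨t, ht, h0, h1⟩ := exists_allocation_ge hM (ha0 0) h (haK 1) (by linarith)
    refine ⟨t, ht, ?_⟩
    have hm := hmixed ![t.2, t.1] (by simp [Fin.forall_fin_two, h0, h1])
      (by simpa [Fin.forall_fin_two] using ⟨ht.2.1.trans ht.2.2.1, ht.2.2.1⟩)
    have e0 := mul_le_mul_of_nonneg_left (hmono h0) hq0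
    have e1 := mul_le_mul_of_nonneg_left (hmono h1) hq1
    have e2 := mul_nonneg (sub_nonneg.2 hq01) (sub_nonneg.2 (hmono h))
    simp only [Matrix.cons_val_zero, Matrix.cons_val_one] at hm
    rw [max_comm, add_comm (interp K 2 t.2), add_comm (interp K 1 t.2)] at hm
    unfold rateBar
    linarith

/-- No family of placements and messages beats a lower bound of the rate expression. -/
theorem le_of_achievesExpectedRate {𝔽 : Type u} [Field 𝔽] [Fintype 𝔽] {K : ℕ} (hK : 1 ≤ K)
    {p : Fin 2 → ℝ} (hp1 : 0 ≤ p 1) (hp01 : p 1 ≤ p 0) (hp : p 0 + p 1 = 1) {M : ℝ} (hM : M ≤ 2)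
    {Ropt : ℝ} (hR : ∀ t ∈ allocations K M, Ropt ≤ rateBar K p t) {r : ℝ}
    (h : ExpectedRateAchievable 𝔽 K 2 M p r) : Ropt ≤ r := by
  obtain ⟨A, B, X, hmem, R, hX, hlim⟩ := h
  rw [← EReal.coe_le_coe_iff]
  refine le_trans ?_ hlim
  refine Filter.le_limsup_of_frequently_le (Filter.Eventually.frequently ?_)
  filter_upwards [Filter.eventually_ge_atTop 1] with F hF
  obtain ⟨t, ht, hle⟩ := exists_rateBar_le hK hF hp1 hp01 hp hM (A F) (hmem F) (X F)
    (fun d => R d F) (fun d => hX d F)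
  exact_mod_cast (hR t ht).trans hle

end CodedCaching


theorem mainTheorem1 (K : ℕ) (hK : 1 ≤ K) :
    ∃ q₀ : ℕ, ∀ (𝔽 : Type u) [Field 𝔽] [Fintype 𝔽], q₀ ≤ Fintype.card 𝔽 →
      ∀ (p : Fin 2 → ℝ), 0 ≤ p 1 → p 1 ≤ p 0 → p 0 + p 1 = 1 →
      ∀ (M : ℝ), 0 ≤ M → M ≤ 2 →
      ∃ Ropt : ℝ,
        IsLeast (CodedCaching.rateBar K p '' CodedCaching.allocations K M) Ropt ∧
        IsLeast {R : ℝ | CodedCaching.ExpectedRateAchievable 𝔽 K 2 M p R} Ropt ∧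
        ∀ t ∈ CodedCaching.allocations K M, CodedCaching.rateBar K p t = Ropt →
          (∀ F : ℕ, Nonempty (CodedCaching.JointChoices 𝔽 K t F)) ∧
          ∀ c : (F : ℕ) → CodedCaching.JointChoices 𝔽 K t F,
            CodedCaching.AchievesExpectedRate M p (fun F => (c F).placement)
              (fun F d => (c F).message d) Ropt := by
  open CodedCaching in
  refine ⟨2 * (2 ^ K) ^ 2, fun 𝔽 _ _ hq p hp1 hp01 hp M hM0 hM2 => ?_⟩
  have hp0 := hp1.trans hp01
  have hne : (allocations K M).Nonempty := by
    obtain ⟨t, ht, -⟩ := exists_allocation_ge (K := K) (a := 0) (b := 0) hM2 le_rfl le_rfl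
      (by positivity) (by simp only [add_zero]; positivity)
    exact ⟨t, ht⟩
  obtain ⟨s, hs, hmin⟩ := (isCompact_allocations K M).exists_isMinOn hne
    (continuousOn_rateBar hK p M)
  have hle : ∀ t ∈ allocations K M, rateBar K p s ≤ rateBar K p t := fun t ht => hmin ht
  have hex : ∀ t ∈ allocations K M, ∀ F, Nonempty (JointChoices 𝔽 K t F) := fun t ht F =>
    nonempty_jointChoices hK hq ht.1 ht.2.1 F
  refine ⟨rateBar K p s, ⟨⟨s, hs, rfl⟩, ?_⟩, ⟨?_, ?_⟩, fun t ht hts => ⟨hex t ht, fun c => ?_⟩⟩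
  · rintro _ ⟨t, ht, rfl⟩
    exact hle t ht
  · exact ⟨_, _, _, jointScheme_achieves hK hp0 hp1 hp hs fun F => (hex s hs F).some⟩
  · intro r hr
    exact le_of_achievesExpectedRate hK hp1 hp01 hp hM2 hle hr
  · rw [← hts]
    exact jointScheme_achieves hK hp0 hp1 hp ht c
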